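/- Let $\Omega\subset\mathbb R^3$ be a bounded convex domain (non-empty, open) with $C^1$ boundary, and let $n_y$ denote the outward unit normal at $y\in\partial\Omega$. Let $h,c,k>0$, let $B_\nu(T)=\frac{2h\nu^3}{c^2}\,\frac{1}{e^{h\nu/(kT)}-1}$ be the Planck function, and let $\alpha>0$ be a constant absorption coefficient. Let $g_\nu(n)\ge 0$ ($\nu>0$, $n\in\mathbb S^2$) be incoming radiation data independent of the position, with $$0<\int_{\mathbb S^2}\int_0^\infty g_\nu(n)\,d\nu\,dn<\infty .$$ Then there is one and, up to equality almost everywhere, only one temperature distribution $T\in L^4(\Omega)$ with $T>0$ a.e. in $\Omega$ for which there exists an intensity $I_\nu(x,n)$, integrable on $(0,\infty)\times\Omega\times\mathbb S^2$, that satisfies * the stationary transfer equation $n\cdot\nabla_x I_\nu=\alpha\,(B_\nu(T)-I_\nu)$ in $\Omega$: along almost every characteristic, $t\mapsto I_\nu(x+tn,n)$ is locally absolutely continuous in $\Omega$ and satisfies the equation for almost every $t$; * the incoming boundary condition $I_\nu(y,n)=g_\nu(n)$ for $y\in\partial\Omega$, $n\cdot n_y<0$, as the limit along almost every characteristic at the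 point where it enters $\Omega$; * the conservation law $\nabla_x\cdot\mathcal F=0$ in $\Omega$ in the sense of distributions, where $\mathcal F(x)=\int_0^\infty\int_{\mathbb S^2}n\,I_\nu(x,n)\,dn\,d\nu$. -/

import Mathlib

open MeasureTheory Set Filter
open scoped Topology ContDiff

noncomputable section

namespace RadiativeTransfer

/-- Physical space `ℝ³` with its Euclidean norm. -/
abbrev Space : Type := EuclideanSpace ℝ (Fin 3)

/-- The sphere `𝕊²` of directions. -/
abbrev Dir : Type := Metric.sphere (0 : Space) 1

/-- The surface measure `dn` on `𝕊²` (total mass `4π`). -/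
abbrev dirMeasure : Measure Dir := (volume : Measure Space).toSphere

/-- The measure `dν` on the frequencies `ν ∈ (0, ∞)`. -/
abbrev freqMeasure : Measure ℝ := volume.restrict (Ioi 0)

/-- The measure `dν dx dn` on `(0, ∞) × Ω × 𝕊²`. -/
abbrev phaseMeasure (Ω : Set Space) : Measure (ℝ × Space × Dir) :=
  freqMeasure.prod ((volume.restrict Ω).prod dirMeasure)

/-- `ρ` is a `C¹` defining function of `Ω` near the boundary point `y`:
`Ω = {ρ < 0}` near `y`, `ρ y = 0` and `∇ρ y ≠ 0`. -/
def IsLocalDefiningFunction (Ω : Set Space) (y : Space) (ρ : Space → ℝ) : Prop :=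
  ContDiffAt ℝ 1 ρ y ∧ ρ y = 0 ∧ gradient ρ y ≠ 0 ∧ ∀ᶠ x in 𝓝 y, (x ∈ Ω ↔ ρ x < 0)

/-- The boundary of `Ω` is of class `C¹` (and `Ω` lies locally on one side of it). -/
def HasC1Boundary (Ω : Set Space) : Prop :=
  ∀ y ∈ frontier Ω, ∃ ρ : Space → ℝ, IsLocalDefiningFunction Ω y ρ

/-- `m` is the outward unit normal `n_y` of `Ω` at the boundary point `y`. -/
def IsOutwardUnitNormal (Ω : Set Space) (y m : Space) : Prop :=
  ∃ ρ : Space → ℝ, IsLocalDefiningFunction Ω y ρ ∧ m = ‖gradient ρ y‖⁻¹ • gradient ρ y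

/-- The Planck emission of a black body,
`B_ν(T) = (2 h ν³ / c²) / (exp (h ν / (k T)) - 1)`. -/
def planck (h c k ν T : ℝ) : ℝ :=
  2 * h * ν ^ 3 / c ^ 2 * (1 / (Real.exp (h * ν / (k * T)) - 1))

/-- The stationary transfer equation `n · ∇ₓ I_ν = α (B_ν(T) - I_ν)` in `Ω`, with emission and
absorption only. As `T` is only defined almost everywhere, the equation is understood along the
characteristics: for almost every `(ν, x, n)` the function `t ↦ I_ν(x + t n, n)` is absolutely
continuous on each compact interval on which `x + t n` stays in `Ω`, and it satisfies the
equation at almost every `t`. -/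
def SolvesTransferEquation (h c k α : ℝ) (Ω : Set Space) (T : Space → ℝ)
    (I : ℝ → Space → Dir → ℝ) : Prop :=
  ∀ᵐ p ∂(phaseMeasure Ω), ∀ a b : ℝ, a ≤ b →
    (∀ t ∈ Icc a b, p.2.1 + t • (p.2.2 : Space) ∈ Ω) →
      AbsolutelyContinuousOnInterval
        (fun t : ℝ => I p.1 (p.2.1 + t • (p.2.2 : Space)) p.2.2) a b ∧
      ∀ᵐ t ∂(volume.restrict (Icc a b)),
        HasDerivAt (fun t : ℝ => I p.1 (p.2.1 + t • (p.2.2 : Space)) p.2.2)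
          (α * (planck h c k p.1 (T (p.2.1 + t • (p.2.2 : Space)))
            - I p.1 (p.2.1 + t • (p.2.2 : Space)) p.2.2)) t

/-- The incoming boundary condition `I_ν(y, n) = g_ν(n)` for `y ∈ ∂Ω` and `n · n_y < 0`, as a
limit along the characteristic that enters `Ω` at `y`. It is imposed on almost every
characteristic: for almost every `(ν, x, n)`, at the boundary point `y = x - s n`, `s > 0`. -/
def HasIncomingData (Ω : Set Space) (g : ℝ → Dir → ℝ) (I : ℝ → Space → Dir → ℝ) : Prop :=
  ∀ᵐ p ∂(phaseMeasure Ω), ∀ (s : ℝ) (y m : Space), 0 < s →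
    y = p.2.1 - s • (p.2.2 : Space) → y ∈ frontier Ω →
    IsOutwardUnitNormal Ω y m → inner ℝ (p.2.2 : Space) m < 0 →
      Tendsto (fun t : ℝ => I p.1 (y + t • (p.2.2 : Space)) p.2.2) (𝓝[>] 0) (𝓝 (g p.1 p.2.2))

/-- The total flux of radiation energy `F(x) = ∫₀^∞ dν ∫_{𝕊²} n I_ν(x, n) dn`. -/
def flux (I : ℝ → Space → Dir → ℝ) (x : Space) : Space :=
  ∫ ν in Ioi (0 : ℝ), ∫ n : Dir, I ν x n • (n : Space) ∂dirMeasure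

/-- `∇ · F = 0` in `Ω` in the sense of distributions. -/
def IsDivergenceFree (Ω : Set Space) (F : Space → Space) : Prop :=
  ∀ φ : Space → ℝ, ContDiff ℝ ∞ φ → HasCompactSupport φ → tsupport φ ⊆ Ω →
    ∫ x in Ω, inner ℝ (F x) (gradient φ x) = 0

/-- `(T, I)` solves the system: the intensity `I` is integrable (so that its total flux is a well
defined element of `L¹(Ω)`), it satisfies the transfer equation with temperature `T` and the
incoming boundary condition, and its total flux is divergence free. -/
structure IsSolution (h c k α : ℝ) (Ω : Set Space) (g : ℝ → Dir → ℝ) (T : Space → ℝ)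
    (I : ℝ → Space → Dir → ℝ) : Prop where
  integrable : Integrable (fun p : ℝ × Space × Dir => I p.1 p.2.1 p.2.2) (phaseMeasure Ω)
  transfer : SolvesTransferEquation h c k α Ω T I
  incoming : HasIncomingData Ω g I
  conservation : IsDivergenceFree Ω (flux I)

/-- `T` is a positive solution of the system in `L⁴(Ω)`: it is the local temperature distribution
of some radiation field `I`. -/
structure IsPositiveTemperature (h c k α : ℝ) (Ω : Set Space) (g : ℝ → Dir → ℝ)
    (T : Space → ℝ) : Prop where
  memLp : MemLp T 4 (volume.restrict Ω)
  pos : ∀ᵐ x ∂(volume.restrict Ω), 0 < T x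
  exists_intensity : ∃ I : ℝ → Space → Dir → ℝ, IsSolution h c k α Ω g T I

end RadiativeTransfer

end

/-!
Existence and uniqueness of the radiative equilibrium temperature in a medium that only
emits and absorbs.

Along a characteristic the transfer equation is a scalar linear equation, so its solution with the
incoming data `g` is given by variation of constants (`lineSol`, `eq_lineSol`). Hence the intensity
is determined almost everywhere by the temperature (`generated`, `ae_eq_generated`); convexity
makes each characteristic meet `Ω` in a single chord, and the `C¹` boundary guarantees that the
boundary condition is imposed at the entry point of each of them (`exists_normal_inner_neg`).
Integrated over frequencies and directions and tested along characteristics, the transfer equation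
says that the divergence of the flux is `α` times emission minus absorption, so that the
conservation law means that the two balance almost everywhere (`isDivergenceFree_flux_iff`).

By the Stefan-Boltzmann law (`lintegral_planck`) the emission depends on `T` only through
`w = σ T⁴`, and the balance becomes the linear integral equation `|𝕊²| w = G + K w`, where `G > 0`
is the attenuated incoming energy and `K w` is the energy received from `Ω` itself
(`isDivergenceFree_iff_integral_equation`). A path in `Ω` has length at most some `D`, so at most
the fraction `q = 1 - exp (-α D) < 1` of the radiation is absorbed on it. Therefore `K / |𝕊²|`
contracts both `L^∞` (`received_le`) and `L¹` (`lintegral_received_le`) by the factor `q`: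
the Neumann series converges to a bounded positive solution (`exists_solution_integral_equation`),
and the solution is
unique in `L¹(Ω)` (`ae_eq_of_integral_equation`), which is the class that corresponds to
`T ∈ L⁴(Ω)`.

Changes of variables along characteristics are carried out without coordinates adapted to the
direction: the map `(p, t) ↦ (p transported by t, -t)` preserves the measure on phase space times
`ℝ` (`measurePreserving_transport`).
-/

noncomputable section

namespace RadiativeTransfer

/-! ### Characteristics of a bounded convex domain -/

section Geometry

variable {Ω : Set Space}

lemma norm_dir (n : Dir) : ‖(n : Space)‖ = 1 := by
  simp

/-- The characteristic through a point of `Ω` entered `Ω` at a positive distance `s` backwards, and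
never meets `Ω` before that. -/
lemma exists_entry (hΩo : IsOpen Ω) (hΩb : Bornology.IsBounded Ω) (hΩc : Convex ℝ Ω) {x : Space}
    (hx : x ∈ Ω) (n : Dir) :
    ∃ s : ℝ, 0 < s ∧ x - s • (n : Space) ∈ frontier Ω ∧
      ∀ t : ℝ, 0 ≤ t → (x - t • (n : Space) ∈ Ω ↔ t < s) := by
  set A : Set ℝ := {t | 0 ≤ t ∧ x - t • (n : Space) ∈ Ω} with hA
  have hcont : Continuous fun t : ℝ => x - t • (n : Space) := by fun_prop
  have h0 : (0 : ℝ) ∈ A := by simp [hA, hx]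
  obtain ⟨C, hC⟩ := hΩb.exists_norm_le
  have hbdd : BddAbove A := by
    refine ⟨2 * C, fun t ht => ?_⟩
    have h1 := hC _ ht.2
    have h2 := hC _ hx
    have h3 : ‖t • (n : Space)‖ = t := by
      rw [norm_smul, norm_dir, mul_one, Real.norm_of_nonneg ht.1]
    have h4 : ‖t • (n : Space)‖ ≤ ‖x‖ + ‖x - t • (n : Space)‖ := by
      have := norm_sub_le x (x - t • (n : Space))
      simpa using this
    linarith
  have hdown : ∀ t ∈ A, ∀ r, 0 ≤ r → r ≤ t → x - r • (n : Space) ∈ Ω := by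
    intro t ht r hr hrt
    rcases hr.eq_or_lt with rfl | hr0
    · simpa using hx
    have htp : 0 < t := hr0.trans_le hrt
    have := hΩc hx ht.2 (a := 1 - r / t) (b := r / t)
      (by rw [sub_nonneg, div_le_one htp]; exact hrt) (by positivity) (by ring)
    convert this using 1
    rw [smul_sub, smul_smul, div_mul_cancel₀ _ htp.ne', sub_smul, one_smul]
    abel
  have hopen : IsOpen {t : ℝ | x - t • (n : Space) ∈ Ω} := hΩo.preimage hcont
  set s := sSup A with hs
  have hsnot : x - s • (n : Space) ∉ Ω := by
    intro hmem
    obtain ⟨ε, hε, hball⟩ := Metric.isOpen_iff.1 hopen s hmem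
    have h1 : s + ε / 2 ∈ A := by
      refine ⟨by linarith [le_csSup hbdd h0], hball ?_⟩
      simp only [Metric.mem_ball, Real.dist_eq]
      rw [add_sub_cancel_left, abs_of_pos (by positivity)]
      linarith
    linarith [le_csSup hbdd h1]
  have hiff : ∀ t : ℝ, 0 ≤ t → (x - t • (n : Space) ∈ Ω ↔ t < s) := by
    intro t ht
    constructor
    · intro hmem
      refine lt_of_le_of_ne (le_csSup hbdd ⟨ht, hmem⟩) ?_
      rintro rfl
      exact hsnot hmem
    · intro hlt
      obtain ⟨r, hr, htr⟩ := exists_lt_of_lt_csSup ⟨0, h0⟩ hlt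
      exact hdown r hr t ht htr.le
  have hspos : 0 < s := (hiff 0 le_rfl).1 (by simpa using hx)
  refine ⟨s, hspos, ?_, hiff⟩
  rw [hΩo.frontier_eq]
  refine ⟨?_, hsnot⟩
  have : (fun t : ℝ => x - t • (n : Space)) s ∈ closure Ω := by
    have hm : s ∈ closure (Ico 0 s) := by
      rw [closure_Ico hspos.ne]; exact ⟨hspos.le, le_rfl⟩
    refine map_mem_closure (f := fun t : ℝ => x - t • (n : Space)) hcont hm ?_
    intro t ht
    exact (hiff t ht.1).2 ht.2
  exact this

/-- The points of `Ω` on the characteristic through `x` form an interval. -/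
lemma ordConnected_chord (hΩc : Convex ℝ Ω) (x : Space) (n : Dir) :
    OrdConnected {t : ℝ | x + t • (n : Space) ∈ Ω} := by
  have : Convex ℝ {t : ℝ | x + t • (n : Space) ∈ Ω} := by
    have h := hΩc.affine_preimage (AffineMap.lineMap x (x + (n : Space)) : ℝ →ᵃ[ℝ] Space)
    have e : (AffineMap.lineMap x (x + (n : Space)) : ℝ →ᵃ[ℝ] Space) ⁻¹' Ω
        = {t : ℝ | x + t • (n : Space) ∈ Ω} := by
      ext t
      simp [AffineMap.lineMap_apply_module', add_comm]
    rwa [e] at h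
  exact this.ordConnected

/-- A boundary point behind a point of `Ω` is the point where the characteristic enters `Ω`. -/
lemma frontier_unique (hΩo : IsOpen Ω) (hΩc : Convex ℝ Ω) {x : Space}
    (hx : x ∈ Ω) (n : Dir) {s s' : ℝ} (hs' : 0 < s')
    (hfr : x - s' • (n : Space) ∈ frontier Ω) (hfr' : x - s • (n : Space) ∈ frontier Ω)
    (hspos : 0 < s) : s' = s := by
  have key : ∀ {a b : ℝ}, 0 < a → a < b → x - b • (n : Space) ∈ frontier Ω →
      x - a • (n : Space) ∈ Ω := by
    intro a b ha hab hb
    have hb0 : 0 < b := ha.trans hab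
    have h1 := hΩc.combo_interior_closure_mem_interior (x := x) (y := x - b • (n : Space))
      (by rwa [hΩo.interior_eq]) (frontier_subset_closure hb)
      (a := 1 - a / b) (b := a / b) (by rw [sub_pos, div_lt_one hb0]; exact hab)
      (by positivity) (by ring)
    rw [hΩo.interior_eq] at h1
    convert h1 using 1
    rw [smul_sub, smul_smul, div_mul_cancel₀ _ hb0.ne', sub_smul, one_smul]
    abel
  have hn : x - s' • (n : Space) ∉ Ω := by
    rw [hΩo.frontier_eq] at hfr; exact hfr.2
  have hn' : x - s • (n : Space) ∉ Ω := by
    rw [hΩo.frontier_eq] at hfr'; exact hfr'.2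
  rcases lt_trichotomy s' s with h | h | h
  · exact absurd (key hs' h hfr') hn
  · exact h
  · exact absurd (key hspos h hfr) hn'

/-- A characteristic issuing from a boundary point `y` into `Ω` is transversal to the boundary: it
makes a negative scalar product with the outward normal. -/
lemma exists_normal_inner_neg (hΩo : IsOpen Ω) (hΩc : Convex ℝ Ω) (hC1 : HasC1Boundary Ω)
    {y : Space} (hy : y ∈ frontier Ω) :
    ∃ m, IsOutwardUnitNormal Ω y m ∧ ∀ v : Space, y + v ∈ Ω → inner ℝ v m < 0 := by
  obtain ⟨ρ, hρ⟩ := hC1 y hy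
  have hρ' := hρ
  obtain ⟨hdiff, hρ0, hgrad, hloc⟩ := hρ'
  refine ⟨‖gradient ρ y‖⁻¹ • gradient ρ y, ⟨ρ, hρ, rfl⟩, ?_⟩
  have hle : ∀ v : Space, y + v ∈ Ω → inner ℝ v (gradient ρ y) ≤ 0 := by
    intro v hv
    have hg : HasGradientAt ρ (gradient ρ y) y :=
      (hdiff.differentiableAt (by simp)).hasGradientAt
    have hline : HasDerivAt (fun t : ℝ => y + t • v) v 0 := by
      simpa using ((hasDerivAt_id (0 : ℝ)).smul_const v).const_add y
    have hg' : HasFDerivAt ρ (InnerProductSpace.toDual ℝ Space (gradient ρ y))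
        ((fun t : ℝ => y + t • v) 0) := by
      simpa using hg.hasFDerivAt
    have hd := hg'.comp_hasDerivAt 0 hline
    rw [InnerProductSpace.toDual_apply_apply, real_inner_comm] at hd
    have hslope := (hasDerivAt_iff_tendsto_slope_left_right.1 hd).2
    refine le_of_tendsto hslope ?_
    have hev : ∀ᶠ t in 𝓝[>] (0 : ℝ), (y + t • v ∈ Ω ↔ ρ (y + t • v) < 0) := by
      have : Tendsto (fun t : ℝ => y + t • v) (𝓝[>] 0) (𝓝 y) := by
        have h := hline.continuousAt.tendsto
        simp only [zero_smul, add_zero] at h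
        exact h.mono_left nhdsWithin_le_nhds
      exact this.eventually hloc
    filter_upwards [hev, Ioo_mem_nhdsGT (zero_lt_one' ℝ)] with t ht ht01
    have hmem : y + t • v ∈ Ω := by
      have := hΩc.combo_interior_closure_mem_interior (x := y + v) (y := y)
        (by rwa [hΩo.interior_eq]) (frontier_subset_closure hy) (a := t) (b := 1 - t)
        ht01.1 (by linarith [ht01.2]) (by ring)
      rw [hΩo.interior_eq] at this
      convert this using 1
      rw [smul_add, sub_smul, one_smul]
      abel
    have hneg := ht.1 hmem
    simp only [slope_def_field, Function.comp, zero_smul, add_zero, hρ0, sub_zero]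
    exact div_nonpos_of_nonpos_of_nonneg hneg.le ht01.1.le
  intro v hv
  obtain ⟨ε, hε, hball⟩ := Metric.isOpen_iff.1 hΩo _ hv
  have hgp : 0 < ‖gradient ρ y‖ := norm_pos_iff.2 hgrad
  -- a strict inequality: the half space condition also holds after a small shift along the gradient
  set δ := ε / 2 / ‖gradient ρ y‖ with hδ
  have hδp : 0 < δ := by positivity
  have h1 := hle (v + δ • gradient ρ y) (hball (by
    rw [Metric.mem_ball, dist_eq_norm, ← add_assoc, add_sub_cancel_left, norm_smul,
      Real.norm_of_nonneg hδp.le, hδ, div_mul_cancel₀ _ hgp.ne']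
    linarith))
  rw [inner_add_left, inner_smul_left, real_inner_self_eq_norm_sq] at h1
  simp only [conj_trivial] at h1
  have h2 : 0 < δ * ‖gradient ρ y‖ ^ 2 := by positivity
  rw [inner_smul_right]
  have : inner ℝ v (gradient ρ y) < 0 := by linarith
  exact mul_neg_of_pos_of_neg (by positivity) this

end Geometry

/-! ### Transport along characteristics -/

-- shortcut instances: the general search for them is slow
instance : IsFiniteMeasure dirMeasure := inferInstance
instance : SFinite dirMeasure := inferInstance
instance : SFinite (volume : Measure Space) := inferInstance
instance (s : Set Space) : SFinite ((volume : Measure Space).restrict s) := inferInstance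
instance : SFinite ((volume : Measure Space).prod dirMeasure) := inferInstance
instance (s : Set Space) : SFinite (((volume : Measure Space).restrict s).prod dirMeasure) :=
  inferInstance

/-- The phase space of frequencies, positions and directions. -/
abbrev Phase : Type := ℝ × Space × Dir

/-- Free transport of a point of phase space over the distance `t`. -/
def move (p : Phase) (t : ℝ) : Phase := (p.1, p.2.1 + t • (p.2.2 : Space), p.2.2)

/-- The measure `dν dx dn` on the phase space of the whole space. -/
def fullMeasure : Measure Phase := freqMeasure.prod ((volume : Measure Space).prod dirMeasure)

instance : SFinite fullMeasure := by unfold fullMeasure; infer_instance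

/-- The part of phase space that lies over `Ω`. -/
def above (Ω : Set Space) : Set Phase := {p | p.2.1 ∈ Ω}

lemma measurableSet_above {Ω : Set Space} (hΩ : MeasurableSet Ω) : MeasurableSet (above Ω) :=
  hΩ.preimage (by fun_prop)

lemma phaseMeasure_eq (Ω : Set Space) :
    phaseMeasure Ω = fullMeasure.restrict (above Ω) := by
  have h1 : (volume.restrict Ω).prod dirMeasure
      = ((volume : Measure Space).prod dirMeasure).restrict (Ω ×ˢ univ) := by
    rw [← Measure.prod_restrict, Measure.restrict_univ]
  have h2 : phaseMeasure Ω = fullMeasure.restrict (univ ×ˢ (Ω ×ˢ univ)) := by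
    rw [fullMeasure, ← Measure.prod_restrict, ← h1, Measure.restrict_univ]
  rw [h2]
  congr 1
  ext p
  simp [above]

lemma measurable_move : Measurable fun q : Phase × ℝ => move q.1 q.2 := by
  unfold move
  have : Continuous fun q : Phase × ℝ => (q.1.1, q.1.2.1 + q.2 • (q.1.2.2 : Space), q.1.2.2) := by
    fun_prop
  exact this.measurable

@[simp] lemma move_zero (p : Phase) : move p 0 = p := by simp [move]

lemma move_move (p : Phase) (s t : ℝ) : move (move p s) t = move p (s + t) := by
  simp [move, add_smul, add_assoc]

/-- Transport, with reversal of the distance travelled: an involution of `Phase × ℝ`. -/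
def transport (q : Phase × ℝ) : Phase × ℝ := (move q.1 q.2, -q.2)

lemma measurable_transport : Measurable transport :=
  measurable_move.prodMk (by fun_prop)

lemma lintegral_transport {F : Phase × ℝ → ENNReal} (hF : Measurable F) :
    ∫⁻ q, F (transport q) ∂(fullMeasure.prod volume) = ∫⁻ q, F q ∂(fullMeasure.prod volume) := by
  -- integrate over the position first and use translation invariance in it
  have key : ∀ G : Phase × ℝ → ENNReal, Measurable G →
      ∫⁻ q, G q ∂(fullMeasure.prod volume)
        = ∫⁻ ν, ∫⁻ n, ∫⁻ t, ∫⁻ x, G ((ν, x, n), t) ∂(volume : Measure Space)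
          ∂(volume : Measure ℝ) ∂dirMeasure ∂freqMeasure := by
    intro G hG
    rw [lintegral_prod _ hG.aemeasurable, fullMeasure,
      lintegral_prod _ hG.lintegral_prod_right'.aemeasurable]
    refine lintegral_congr fun ν => ?_
    have h1 : Measurable fun y : Space × Dir => ∫⁻ t, G ((ν, y), t) :=
      hG.lintegral_prod_right'.comp (measurable_prodMk_left)
    rw [lintegral_prod _ h1.aemeasurable, lintegral_lintegral_swap h1.aemeasurable]
    refine lintegral_congr fun n => ?_
    rw [lintegral_lintegral_swap]
    exact (hG.comp (by fun_prop : Measurable fun z : Space × ℝ => ((ν, z.1, n), z.2))).aemeasurable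
  rw [key F hF, key (fun q => F (transport q)) (hF.comp measurable_transport)]
  refine lintegral_congr fun ν => lintegral_congr fun n => ?_
  have : ∀ t : ℝ, ∫⁻ x : Space, F (transport ((ν, x, n), t)) = ∫⁻ x : Space, F ((ν, x, n), -t) := by
    intro t
    simp only [transport, move]
    exact lintegral_add_right_eq_self (fun x : Space => F ((ν, x, n), -t)) _
  simp_rw [this]
  exact lintegral_neg_eq_self (fun t : ℝ => ∫⁻ x : Space, F ((ν, x, n), t))

lemma measurePreserving_transport :
    MeasurePreserving transport (fullMeasure.prod volume) (fullMeasure.prod volume) := by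
  refine ⟨measurable_transport, Measure.ext fun s hs => ?_⟩
  rw [Measure.map_apply measurable_transport hs, ← lintegral_indicator_one hs,
    ← lintegral_indicator_one (measurable_transport hs)]
  exact lintegral_transport (F := s.indicator 1) (measurable_one.indicator hs)

/-- A property that holds almost everywhere over `Ω` holds at almost every point of almost every
characteristic. -/
lemma ae_ae_move {Ω : Set Space} (hΩ : MeasurableSet Ω) {P : Phase → Prop}
    (h : ∀ᵐ p ∂(phaseMeasure Ω), P p) :
    ∀ᵐ p ∂(phaseMeasure Ω), ∀ᵐ t : ℝ, p.2.1 + t • (p.2.2 : Space) ∈ Ω → P (move p t) := by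
  rw [phaseMeasure_eq, ae_restrict_iff' (measurableSet_above hΩ)] at h
  have h1 : ∀ᵐ q ∂(fullMeasure.prod (volume : Measure ℝ)),
      (transport q).1 ∈ above Ω → P (transport q).1 :=
    measurePreserving_transport.quasiMeasurePreserving.ae
      (Measure.quasiMeasurePreserving_fst.ae h)
  have h2 := Measure.ae_ae_of_ae_prod h1
  rw [phaseMeasure_eq]
  exact ae_restrict_of_ae h2

/-- The length of the chord that the characteristic through `p` cuts out of `Ω`. -/
def chord (Ω : Set Space) (p : Phase) : ENNReal := volume {t : ℝ | p.2.1 + t • (p.2.2 : Space) ∈ Ω}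

lemma measurableSet_chord {Ω : Set Space} (hΩ : MeasurableSet Ω) (p : Phase) :
    MeasurableSet {t : ℝ | p.2.1 + t • (p.2.2 : Space) ∈ Ω} :=
  hΩ.preimage (by fun_prop)

lemma measurable_chord {Ω : Set Space} (hΩ : MeasurableSet Ω) : Measurable (chord Ω) := by
  have : MeasurableSet {q : Phase × ℝ | (move q.1 q.2) ∈ above Ω} :=
    (measurableSet_above hΩ).preimage measurable_move
  exact measurable_measure_prodMk_left this

lemma chord_move (Ω : Set Space) (p : Phase) (t : ℝ) : chord Ω (move p t) = chord Ω p := by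
  have : {r : ℝ | (move p t).2.1 + r • ((move p t).2.2 : Space) ∈ Ω}
      = (fun r => t + r) ⁻¹' {r : ℝ | p.2.1 + r • (p.2.2 : Space) ∈ Ω} := by
    ext r
    simp [move, add_smul, add_assoc]
  rw [chord, this, measure_preimage_add, chord]

/-- A bound for the chords of a bounded set. -/
lemma exists_chord_bound {Ω : Set Space} (hΩb : Bornology.IsBounded Ω) :
    ∃ D : ℝ, 0 < D ∧ (∀ x ∈ Ω, ∀ (n : Dir) (t : ℝ), x + t • (n : Space) ∈ Ω → |t| ≤ D) ∧
      ∀ p ∈ above Ω, chord Ω p ≤ ENNReal.ofReal (2 * D) := by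
  obtain ⟨C, hC⟩ := hΩb.exists_norm_le
  have h1 : ∀ x ∈ Ω, ∀ (n : Dir) (t : ℝ), x + t • (n : Space) ∈ Ω → |t| ≤ 2 * |C| + 1 := by
    intro x hx n t ht
    have h3 : ‖t • (n : Space)‖ = |t| := by
      rw [norm_smul, norm_dir, mul_one, Real.norm_eq_abs]
    have h4 := norm_sub_le (x + t • (n : Space)) x
    rw [add_sub_cancel_left, h3] at h4
    linarith [hC _ hx, hC _ ht, le_abs_self C]
  refine ⟨2 * |C| + 1, by positivity, h1, fun p hp => ?_⟩
  calc chord Ω p ≤ volume (Icc (-(2 * |C| + 1)) (2 * |C| + 1)) :=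
        measure_mono fun t ht => abs_le.1 (h1 _ hp _ _ ht)
    _ = ENNReal.ofReal (2 * (2 * |C| + 1)) := by rw [Real.volume_Icc]; congr 1; ring

lemma chord_pos {Ω : Set Space} (hΩo : IsOpen Ω) {p : Phase} (hp : p ∈ above Ω) :
    0 < chord Ω p := by
  have ho : IsOpen {t : ℝ | p.2.1 + t • (p.2.2 : Space) ∈ Ω} := hΩo.preimage (by fun_prop)
  exact ho.measure_pos _ ⟨0, by simpa [above] using hp⟩

/-- Integrating `F` along every characteristic and then over `Ω` gives finite mass as soon as `F`
has finite mass. -/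
lemma lintegral_lintegral_move_lt_top {Ω : Set Space} (hΩ : MeasurableSet Ω)
    (hΩb : Bornology.IsBounded Ω) {F : Phase → ENNReal} (hF : Measurable F)
    (hfin : ∫⁻ p, F p ∂(phaseMeasure Ω) < ⊤) :
    ∫⁻ p, (∫⁻ t : ℝ, (above Ω).indicator F (move p t)) ∂(phaseMeasure Ω) < ⊤ := by
  obtain ⟨D, hD, -, hchord⟩ := exists_chord_bound hΩb
  have hO := measurableSet_above hΩ
  have hFi : Measurable ((above Ω).indicator F) := hF.indicator hO
  set H : Phase × ℝ → ENNReal := fun q =>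
    (above Ω).indicator F q.1 * (above Ω).indicator 1 (move q.1 q.2) with hH
  have hHm : Measurable H := (hFi.comp measurable_fst).mul
    ((measurable_one.indicator hO).comp measurable_move)
  have e1 : ∫⁻ p, (∫⁻ t : ℝ, (above Ω).indicator F (move p t)) ∂(phaseMeasure Ω)
      = ∫⁻ q, H (transport q) ∂(fullMeasure.prod volume) := by
    rw [lintegral_prod (fun q => H (transport q)) (hHm.comp measurable_transport).aemeasurable,
      phaseMeasure_eq,
      ← lintegral_indicator hO]
    refine lintegral_congr fun p => ?_
    by_cases hp : p ∈ above Ω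
    · simp [hH, transport, move_move, hp]
    · simp [hH, transport, move_move, hp]
  rw [e1, lintegral_transport hHm, lintegral_prod _ hHm.aemeasurable]
  have e2 : ∀ p, ∫⁻ t : ℝ, H (p, t) ≤ ENNReal.ofReal (2 * D) * (above Ω).indicator F p := by
    intro p
    have hmp : Measurable fun t : ℝ => (above Ω).indicator (1 : Phase → ENNReal) (move p t) :=
      (measurable_one.indicator hO).comp (measurable_move.comp measurable_prodMk_left)
    simp only [hH]
    rw [lintegral_const_mul _ hmp, mul_comm]
    by_cases hp : p ∈ above Ω
    · gcongr
      have : ∀ t : ℝ, (above Ω).indicator (1 : Phase → ENNReal) (move p t)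
          = {t : ℝ | p.2.1 + t • (p.2.2 : Space) ∈ Ω}.indicator 1 t := fun t => rfl
      simp_rw [this]
      rw [lintegral_indicator_one (measurableSet_chord hΩ p)]
      exact hchord p hp
    · simp [hp]
  refine (lintegral_mono e2).trans_lt ?_
  rw [lintegral_const_mul _ hFi, lintegral_indicator hO, ← phaseMeasure_eq]
  exact ENNReal.mul_lt_top ENNReal.ofReal_lt_top hfin

/-- A function whose integral along almost every characteristic vanishes has integral zero. The
weight `1 / chord`, which is constant along characteristics, turns the integral over `Ω` into an
integral over the characteristics without a change of coordinates. -/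
lemma integral_eq_zero_of_ae_integral_move {Ω : Set Space} (hΩo : IsOpen Ω)
    (hΩb : Bornology.IsBounded Ω) {f : Phase → ℝ} (hf : Integrable f (phaseMeasure Ω))
    (h : ∀ᵐ p ∂(phaseMeasure Ω),
      ∫ t in {t : ℝ | p.2.1 + t • (p.2.2 : Space) ∈ Ω}, f (move p t) = 0) :
    ∫ p, f p ∂(phaseMeasure Ω) = 0 := by
  obtain ⟨D, hD, -, hchord⟩ := exists_chord_bound hΩb
  have hΩ := hΩo.measurableSet
  have hO := measurableSet_above hΩ
  set f' : Phase → ℝ := (above Ω).indicator f with hf'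
  have hf'i : Integrable f' fullMeasure := by
    rw [phaseMeasure_eq] at hf
    exact (integrable_indicator_iff hO).2 hf
  set u : Phase → ℝ := (above Ω).indicator 1 with hu
  have hum : Measurable u := measurable_one.indicator hO
  have hcm := measurable_chord hΩ
  set H : Phase × ℝ → ℝ := fun q => (chord Ω q.1).toReal⁻¹ * f' q.1 * u (move q.1 q.2) with hH
  have hu1 : ∀ (p : Phase) (t : ℝ), u (move p t)
      = {t : ℝ | p.2.1 + t • (p.2.2 : Space) ∈ Ω}.indicator 1 t := fun p t => rfl
  have hint : ∀ p : Phase, ∫ t, u (move p t) = (chord Ω p).toReal := by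
    intro p
    simp_rw [hu1]
    rw [integral_indicator_one (measurableSet_chord hΩ p)]
    rfl
  have hui : ∀ p ∈ above Ω, Integrable fun t => u (move p t) := by
    intro p hp
    simp_rw [hu1]
    exact (integrable_indicator_iff (measurableSet_chord hΩ p)).2
      (integrableOn_const ((hchord p hp).trans_lt ENNReal.ofReal_lt_top).ne)
  have hcancel : ∀ p : Phase, (chord Ω p).toReal⁻¹ * f' p * (chord Ω p).toReal = f' p := by
    intro p
    by_cases hp : p ∈ above Ω
    · have : 0 < (chord Ω p).toReal := ENNReal.toReal_pos (chord_pos hΩo hp).ne'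
        ((hchord p hp).trans_lt ENNReal.ofReal_lt_top).ne
      field_simp
    · simp [hf', hp]
  have hHm : AEStronglyMeasurable H (fullMeasure.prod volume) := by
    refine AEStronglyMeasurable.mul (AEStronglyMeasurable.mul ?_ ?_) ?_
    · exact (hcm.ennreal_toReal.inv.comp measurable_fst).aestronglyMeasurable
    · exact hf'i.1.comp_fst
    · exact (hum.comp measurable_move).aestronglyMeasurable
  have hHi : Integrable H (fullMeasure.prod volume) := by
    refine (integrable_prod_iff hHm).2 ⟨Eventually.of_forall fun p => ?_, ?_⟩
    · by_cases hp : p ∈ above Ω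
      · exact (hui p hp).const_mul ((chord Ω p).toReal⁻¹ * f' p)
      · simp [hH, hf', hp]
    · refine hf'i.norm.congr (Eventually.of_forall fun p => ?_)
      simp only [hH, norm_mul]
      have : ∀ t, ‖u (move p t)‖ = u (move p t) := fun t =>
        Real.norm_of_nonneg (indicator_nonneg (fun _ _ => zero_le_one) _)
      simp_rw [this]
      rw [integral_const_mul, hint, ← norm_mul]
      conv_lhs => rw [← hcancel p, norm_mul]
      rw [Real.norm_of_nonneg (ENNReal.toReal_nonneg (a := chord Ω p))]
  have e1 : ∫ q, H q ∂(fullMeasure.prod volume) = ∫ p, f p ∂(phaseMeasure Ω) := by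
    rw [integral_prod _ hHi, phaseMeasure_eq, ← integral_indicator hO]
    refine integral_congr_ae (Eventually.of_forall fun p => ?_)
    simp only [hH]
    rw [integral_const_mul, hint, hcancel]
  have hHt : Integrable (fun q => H (transport q)) (fullMeasure.prod volume) :=
    measurePreserving_transport.integrable_comp_of_integrable hHi
  have e2 : ∫ q, H (transport q) ∂(fullMeasure.prod volume)
      = ∫ q, H q ∂(fullMeasure.prod volume) := by
    have hmap := measurePreserving_transport.map_eq
    conv_rhs => rw [← hmap]
    rw [integral_map measurable_transport.aemeasurable (by rw [hmap]; exact hHm)]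
  rw [← e1, ← e2, integral_prod _ hHt]
  rw [phaseMeasure_eq, ae_restrict_iff' hO] at h
  refine integral_eq_zero_of_ae ?_
  filter_upwards [h] with p hp
  simp only [hH, transport, chord_move, move_move, add_neg_cancel, move_zero, Pi.zero_apply]
  rw [integral_mul_const, integral_const_mul]
  by_cases hpO : p ∈ above Ω
  · have : ∫ t, f' (move p t) = ∫ t in {t : ℝ | p.2.1 + t • (p.2.2 : Space) ∈ Ω}, f (move p t) := by
      rw [← integral_indicator (measurableSet_chord hΩ p)]
      rfl
    rw [this, hp hpO]
    simp
  · simp [hu, hpO]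

/-! ### The transfer equation on a single characteristic -/

section Line

/-- The solution of `J' = α (β - J)` with `J (-s) = c`, by variation of constants. -/
def lineSol (α : ℝ) (β : ℝ → ℝ) (s c t : ℝ) : ℝ :=
  Real.exp (-α * t) * (c * Real.exp (-α * s) + ∫ r in (-s)..t, α * Real.exp (α * r) * β r)

variable {α : ℝ} {β : ℝ → ℝ}

lemma intervalIntegrable_exp_mul (hβ : Integrable β) (a b : ℝ) :
    IntervalIntegrable (fun r => α * Real.exp (α * r) * β r) volume a b :=
  (hβ.intervalIntegrable).continuousOn_mul (by fun_prop)

lemma locallyIntegrable_exp_mul (hβ : Integrable β) :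
    LocallyIntegrable (fun r => α * Real.exp (α * r) * β r) :=
  hβ.locallyIntegrable.continuous_mul (by fun_prop)

lemma absolutelyContinuousOnInterval_exp (c a b : ℝ) :
    AbsolutelyContinuousOnInterval (fun t => Real.exp (c * t)) a b :=
  ContDiffOn.absolutelyContinuousOnInterval (by fun_prop)

lemma hasDerivAt_exp_mul (c t : ℝ) :
    HasDerivAt (fun t => Real.exp (c * t)) (c * Real.exp (c * t)) t := by
  have := ((hasDerivAt_id t).const_mul c).exp
  simpa [mul_comm] using this

lemma continuous_lineSol (hβ : Integrable β) (s c : ℝ) : Continuous (lineSol α β s c) := by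
  have : Continuous fun t => ∫ r in (-s)..t, α * Real.exp (α * r) * β r :=
    intervalIntegral.continuous_primitive (intervalIntegrable_exp_mul hβ) _
  unfold lineSol
  fun_prop

lemma lineSol_neg_self (s c : ℝ) : lineSol α β s c (-s) = c := by
  rw [lineSol, intervalIntegral.integral_same, add_zero, mul_left_comm, ← Real.exp_add]
  simp

lemma absolutelyContinuousOnInterval_lineSol (hβ : Integrable β) (s c a b : ℝ) :
    AbsolutelyContinuousOnInterval (lineSol α β s c) a b := by
  have h1 : AbsolutelyContinuousOnInterval
      (fun t => ∫ r in a..t, α * Real.exp (α * r) * β r) a b :=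
    (intervalIntegrable_exp_mul hβ a b).absolutelyContinuousOnInterval_intervalIntegral (by simp)
  have h2 : AbsolutelyContinuousOnInterval
      (fun _ : ℝ => c * Real.exp (-α * s) + ∫ r in (-s)..a, α * Real.exp (α * r) * β r) a b :=
    ContDiffOn.absolutelyContinuousOnInterval contDiffOn_const
  have h3 := (absolutelyContinuousOnInterval_exp (-α) a b).fun_mul (h2.fun_add h1)
  convert h3 using 2 with t
  rw [lineSol, add_assoc, intervalIntegral.integral_add_adjacent_intervals] <;>
    exact intervalIntegrable_exp_mul hβ _ _

lemma ae_hasDerivAt_lineSol (hβ : Integrable β) (s c : ℝ) :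
    ∀ᵐ t, HasDerivAt (lineSol α β s c) (α * (β t - lineSol α β s c t)) t := by
  filter_upwards [LocallyIntegrable.ae_hasDerivAt_integral
    (locallyIntegrable_exp_mul (α := α) hβ)] with t ht
  have h := (hasDerivAt_exp_mul (-α) t).mul ((ht (-s)).const_add (c * Real.exp (-α * s)))
  refine h.congr_deriv ?_
  have he : Real.exp (-α * t) * Real.exp (α * t) = 1 := by
    rw [← Real.exp_add]; simp
  rw [lineSol]
  linear_combination (α * β t) * he

/-- Absolutely continuous solutions are given by variation of constants. -/
lemma exp_mul_sub_exp_mul_eq_integral {J : ℝ → ℝ} {a b : ℝ} (hab : a ≤ b)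
    (hJ : AbsolutelyContinuousOnInterval J a b)
    (hJ' : ∀ᵐ t ∂(volume.restrict (Icc a b)), HasDerivAt J (α * (β t - J t)) t) :
    Real.exp (α * b) * J b - Real.exp (α * a) * J a
      = ∫ r in a..b, α * Real.exp (α * r) * β r := by
  rw [← ((absolutelyContinuousOnInterval_exp α a b).fun_mul hJ).integral_deriv_eq_sub]
  refine intervalIntegral.integral_congr_ae ?_
  rw [ae_restrict_iff' measurableSet_Icc] at hJ'
  filter_upwards [hJ'] with t ht htab
  rw [uIoc_of_le hab] at htab
  have h := ((hasDerivAt_exp_mul α t).mul (ht (Ioc_subset_Icc_self htab))).deriv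
  have e : ((fun t => Real.exp (α * t)) * J) = fun t => Real.exp (α * t) * J t := rfl
  rw [e] at h
  rw [h]
  ring

/-- An absolutely continuous solution on `(-s, 0]` that tends to `c` at `-s` is `lineSol`. -/
lemma eq_lineSol (hβ : Integrable β) {J : ℝ → ℝ} {s c : ℝ} (hs : 0 < s)
    (hJ : ∀ a, -s < a → a ≤ 0 → AbsolutelyContinuousOnInterval J a 0 ∧
      ∀ᵐ t ∂(volume.restrict (Icc a 0)), HasDerivAt J (α * (β t - J t)) t)
    (hlim : Tendsto J (𝓝[>] (-s)) (𝓝 c)) : J 0 = lineSol α β s c 0 := by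
  have h1 : ∀ᶠ a in 𝓝[>] (-s), J 0 = Real.exp (α * a) * J a
      + ∫ r in a..0, α * Real.exp (α * r) * β r := by
    filter_upwards [Ioo_mem_nhdsGT (show -s < 0 by linarith)] with a ha
    obtain ⟨hac, hder⟩ := hJ a ha.1 ha.2.le
    have := exp_mul_sub_exp_mul_eq_integral ha.2.le hac hder
    rw [← this]
    simp
  have hprim : Continuous fun a => ∫ r in a..0, α * Real.exp (α * r) * β r := by
    have : Continuous fun a => ∫ r in (0 : ℝ)..a, α * Real.exp (α * r) * β r :=
      intervalIntegral.continuous_primitive (intervalIntegrable_exp_mul hβ) _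
    simp_rw [intervalIntegral.integral_symm (0 : ℝ)]
    exact this.neg
  have hexp : Continuous fun a : ℝ => Real.exp (α * a) := by fun_prop
  have h2 : Tendsto (fun a => Real.exp (α * a) * J a + ∫ r in a..0, α * Real.exp (α * r) * β r)
      (𝓝[>] (-s)) (𝓝 (Real.exp (α * (-s)) * c + ∫ r in (-s)..0, α * Real.exp (α * r) * β r)) :=
    (((hexp.tendsto _).mono_left nhdsWithin_le_nhds).mul hlim).add
      ((hprim.tendsto _).mono_left nhdsWithin_le_nhds)
  have h3 := tendsto_nhds_unique (tendsto_const_nhds.congr' h1) h2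
  rw [h3, lineSol]
  simp [mul_comm]

/-- The product of a solution with a test function that vanishes at both ends has a derivative of
integral zero. -/
lemma integral_deriv_mul_test_eq_zero {J J' ψ ψ' : ℝ → ℝ} {a b : ℝ} (hab : a ≤ b)
    (hJ : AbsolutelyContinuousOnInterval J a b)
    (hJ' : ∀ᵐ t ∂(volume.restrict (Icc a b)), HasDerivAt J (J' t) t)
    (hψ : ContDiff ℝ 1 ψ) (hψ' : ∀ t, HasDerivAt ψ (ψ' t) t) (ha : ψ a = 0) (hb : ψ b = 0) :
    ∫ t in a..b, (J' t * ψ t + J t * ψ' t) = 0 := by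
  have h := (hJ.fun_mul hψ.contDiffOn.absolutelyContinuousOnInterval).integral_deriv_eq_sub
  rw [ha, hb, mul_zero, mul_zero, sub_zero] at h
  rw [← h]
  refine intervalIntegral.integral_congr_ae ?_
  rw [ae_restrict_iff' measurableSet_Icc] at hJ'
  filter_upwards [hJ'] with t ht htab
  rw [uIoc_of_le hab] at htab
  have h := ((ht (Ioc_subset_Icc_self htab)).mul (hψ' t)).deriv
  have e : J * ψ = fun t => J t * ψ t := rfl
  rw [e] at h
  rw [h]

end Line

/-! ### Total emission of a black body -/

section Planck

variable {h c k : ℝ}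

lemma planck_nonneg (hh : 0 < h) (hk : 0 < k) {ν T : ℝ} (hν : 0 < ν) (hT : 0 < T) :
    0 ≤ planck h c k ν T := by
  have : 0 < Real.exp (h * ν / (k * T)) - 1 := by
    rw [sub_pos, Real.one_lt_exp_iff]; positivity
  unfold planck
  positivity

lemma planck_pos (hh : 0 < h) (hc : 0 < c) (hk : 0 < k) {ν T : ℝ} (hν : 0 < ν) (hT : 0 < T) :
    0 < planck h c k ν T := by
  have : 0 < Real.exp (h * ν / (k * T)) - 1 := by
    rw [sub_pos, Real.one_lt_exp_iff]; positivity
  unfold planck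
  positivity

lemma measurable_planck : Measurable fun z : ℝ × ℝ => planck h c k z.1 z.2 := by
  unfold planck
  fun_prop

lemma planck_scale {ν T : ℝ} (hT : 0 < T) :
    planck h c k ν T = T ^ 3 * planck h c k (T⁻¹ * ν) 1 := by
  have : h * (T⁻¹ * ν) / (k * 1) = h * ν / (k * T) := by
    rw [mul_one, ← div_div, div_right_comm]
    ring
  unfold planck
  rw [this]
  field_simp

lemma integrableOn_planck_one (hh : 0 < h) (hk : 0 < k) :
    IntegrableOn (fun ν => planck h c k ν 1) (Ioi 0) := by
  have hb : 0 < h / k / 2 := by positivity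
  have h1 := integrableOn_rpow_mul_exp_neg_mul_rpow (s := 2) (p := 1) (by norm_num) one_pos hb
  refine Integrable.mono' (h1.const_mul (2 * h / c ^ 2 * (2 * k / h))) ?_ ?_
  · exact (measurable_planck.comp
      (by fun_prop : Measurable fun ν : ℝ => (ν, (1 : ℝ)))).aestronglyMeasurable
  · refine (ae_restrict_iff' measurableSet_Ioi).2 (Eventually.of_forall fun ν (hν : 0 < ν) => ?_)
    rw [Real.norm_of_nonneg (planck_nonneg hh hk hν one_pos)]
    set v := h / k / 2 * ν with hv
    have hvp : 0 < v := by positivity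
    -- `e^{2v} - 1 = (e^v - 1) (e^v + 1) ≥ v e^v`
    have hexp : v * Real.exp v ≤ Real.exp (h * ν / (k * 1)) - 1 := by
      have e : h * ν / (k * 1) = v + v := by rw [hv]; field_simp; ring
      rw [e, Real.exp_add]
      nlinarith [Real.add_one_le_exp v, Real.exp_pos v]
    have h2 : 1 / (Real.exp (h * ν / (k * 1)) - 1) ≤ 1 / (v * Real.exp v) :=
      one_div_le_one_div_of_le (by positivity) hexp
    have h3 : planck h c k ν 1 ≤ 2 * h * ν ^ 3 / c ^ 2 * (1 / (v * Real.exp v)) := by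
      unfold planck
      gcongr
    refine h3.trans (le_of_eq ?_)
    have e2 : ν ^ (2 : ℝ) = ν ^ 2 := by norm_cast
    have e3 : Real.exp (-(h / k / 2) * ν ^ (1 : ℝ)) = (Real.exp v)⁻¹ := by
      rw [← Real.exp_neg, Real.rpow_one, hv]; ring_nf
    rw [e2, e3, hv]
    rcases eq_or_ne c 0 with rfl | hc
    · simp
    · field_simp

/-- The constant `σ` of the Stefan-Boltzmann law `∫ B_ν(T) dν = σ T⁴` (here without the usual
factor `π`). -/
def stefan (h c k : ℝ) : ℝ := ∫ ν in Ioi (0 : ℝ), planck h c k ν 1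

lemma stefan_pos (hh : 0 < h) (hc : 0 < c) (hk : 0 < k) : 0 < stefan h c k := by
  unfold stefan
  rw [setIntegral_pos_iff_support_of_nonneg_ae]
  · have : Function.support (fun ν => planck h c k ν 1) ∩ Ioi 0 = Ioi 0 := by
      refine inter_eq_right.2 fun ν hν => ?_
      exact (planck_pos hh hc hk hν one_pos).ne'
    rw [this]
    simp
  · refine (ae_restrict_iff' measurableSet_Ioi).2 (Eventually.of_forall fun ν hν => ?_)
    exact planck_nonneg hh hk hν one_pos
  · exact integrableOn_planck_one hh hk

/-- The Stefan-Boltzmann law. -/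
lemma lintegral_planck (hh : 0 < h) (hk : 0 < k) {T : ℝ} (hT : 0 < T) :
    ∫⁻ ν, ENNReal.ofReal (planck h c k ν T) ∂freqMeasure
      = ENNReal.ofReal (stefan h c k * T ^ 4) := by
  have hTi : 0 < T⁻¹ := inv_pos.2 hT
  have hint : IntegrableOn (fun ν => planck h c k (T⁻¹ * ν) 1) (Ioi 0) := by
    have := integrableOn_Ioi_comp_mul_left_iff (fun ν => planck h c k ν 1) 0 hTi
    rw [this, mul_zero]
    exact integrableOn_planck_one hh hk
  have e : (fun ν => planck h c k ν T) = fun ν => T ^ 3 * planck h c k (T⁻¹ * ν) 1 :=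
    funext fun ν => planck_scale hT
  rw [← ofReal_integral_eq_lintegral_ofReal]
  · congr 1
    rw [e, integral_const_mul]
    have := integral_comp_mul_left_Ioi (fun ν => planck h c k ν 1) 0 hTi
    rw [this, mul_zero, inv_inv, smul_eq_mul, ← stefan]
    ring
  · rw [e]
    exact hint.const_mul _
  · refine (ae_restrict_iff' measurableSet_Ioi).2 (Eventually.of_forall fun ν hν => ?_)
    exact planck_nonneg hh hk hν hT

end Planck

/-! ### The intensity generated by an emission -/

section Intensity

/-- The distance from the boundary back along the characteristic: for `x ∈ Ω` the characteristic
through `x` in the direction `n` enters `Ω` at `x - entryDist Ω x n • n`. -/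
def entryDist (Ω : Set Space) (p : Phase) : ℝ :=
  (volume {t : ℝ | 0 < t ∧ move p (-t) ∈ above Ω}).toReal

/-- The intensity generated by the incoming data `g` and the emission `E`: radiation is attenuated
exponentially on its way along the characteristic. Valued in `[0, ∞]`. -/
def intensity (α : ℝ) (Ω : Set Space) (g : ℝ → Dir → ENNReal) (E : Phase → ENNReal) (p : Phase) :
    ENNReal :=
  g p.1 p.2.2 * ENNReal.ofReal (Real.exp (-α * entryDist Ω p))
    + ∫⁻ t in Ioi (0 : ℝ), ENNReal.ofReal (α * Real.exp (-α * t))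
        * (above Ω).indicator E (move p (-t))

/-- The emission met at distance `t` on the characteristic through `p`, zero outside `Ω` (and
where it is infinite). -/
def emissionAlong (Ω : Set Space) (E : Phase → ENNReal) (p : Phase) (t : ℝ) : ℝ :=
  ((above Ω).indicator E (move p t)).toReal

variable {α : ℝ} {Ω : Set Space} {g : ℝ → Dir → ENNReal} {E : Phase → ENNReal}

lemma measurable_move_neg : Measurable fun q : Phase × ℝ => move q.1 (-q.2) :=
  measurable_move.comp (by fun_prop : Measurable fun q : Phase × ℝ => (q.1, -q.2))

lemma measurable_entryDist (hΩ : MeasurableSet Ω) : Measurable (entryDist Ω) := by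
  have : MeasurableSet {q : Phase × ℝ | 0 < q.2 ∧ move q.1 (-q.2) ∈ above Ω} :=
    (measurableSet_lt measurable_const measurable_snd).inter
      ((measurableSet_above hΩ).preimage measurable_move_neg)
  exact (measurable_measure_prodMk_left this).ennreal_toReal

lemma measurable_intensity (hΩ : MeasurableSet Ω)
    (hg : Measurable fun z : ℝ × Dir => g z.1 z.2) (hE : Measurable E) :
    Measurable (intensity α Ω g E) := by
  refine Measurable.add (Measurable.mul ?_ ?_) ?_
  · exact hg.comp (by fun_prop : Measurable fun p : Phase => (p.1, p.2.2))
  · exact ((Real.measurable_exp).comp ((measurable_entryDist hΩ).const_mul _)).ennreal_ofReal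
  · refine Measurable.lintegral_prod_right' (f := fun q : Phase × ℝ =>
      ENNReal.ofReal (α * Real.exp (-α * q.2)) * (above Ω).indicator E (move q.1 (-q.2))) ?_
    refine Measurable.mul (by fun_prop) ?_
    exact (hE.indicator (measurableSet_above hΩ)).comp measurable_move_neg

/-- Over `Ω`, the points behind a point of the chord are those at signed distance above
`-entryDist Ω p` from `p`. -/
lemma entryDist_spec (hΩo : IsOpen Ω) (hΩb : Bornology.IsBounded Ω) (hΩc : Convex ℝ Ω) {p : Phase}
    (hp : p ∈ above Ω) :
    0 < entryDist Ω p ∧ p.2.1 - entryDist Ω p • (p.2.2 : Space) ∈ frontier Ω ∧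
      ∀ t q : ℝ, move p t ∈ above Ω → q ≤ t → (move p q ∈ above Ω ↔ -entryDist Ω p < q) := by
  obtain ⟨s, hs, hfr, hiff⟩ := exists_entry hΩo hΩb hΩc hp p.2.2
  have hiff' : ∀ q : ℝ, q ≤ 0 → (move p q ∈ above Ω ↔ -s < q) := by
    intro q hq
    have := hiff (-q) (by linarith)
    rw [neg_smul, sub_neg_eq_add] at this
    exact this.trans ⟨fun h => by linarith, fun h => by linarith⟩
  have hs' : entryDist Ω p = s := by
    have : {t : ℝ | 0 < t ∧ move p (-t) ∈ above Ω} = Ioo 0 s := by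
      ext t
      refine and_congr_right fun ht => ?_
      rw [hiff' (-t) (by linarith)]
      exact neg_lt_neg_iff
    rw [entryDist, this, Real.volume_Ioo, sub_zero, ENNReal.toReal_ofReal hs.le]
  rw [hs']
  refine ⟨hs, hfr, fun t q ht hqt => ?_⟩
  rcases le_or_gt q 0 with hq | hq
  · exact hiff' q hq
  · refine ⟨fun _ => by linarith, fun _ => ?_⟩
    exact (ordConnected_chord hΩc p.2.1 p.2.2).out (x := 0) (y := t)
      (by simpa [above] using hp) ht ⟨hq.le, hqt⟩

lemma entryDist_move (hΩo : IsOpen Ω) (hΩb : Bornology.IsBounded Ω) (hΩc : Convex ℝ Ω) {p : Phase}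
    (hp : p ∈ above Ω) {t : ℝ} (ht : move p t ∈ above Ω) :
    entryDist Ω (move p t) = entryDist Ω p + t := by
  obtain ⟨hs, -, hiff⟩ := entryDist_spec hΩo hΩb hΩc hp
  have hst := (hiff t t ht le_rfl).1 ht
  have : {r : ℝ | 0 < r ∧ move (move p t) (-r) ∈ above Ω} = Ioo 0 (entryDist Ω p + t) := by
    ext r
    refine and_congr_right fun hr => ?_
    rw [move_move, hiff t (t + -r) ht (by linarith)]
    exact ⟨fun h => by linarith, fun h => by linarith⟩
  rw [entryDist, this, Real.volume_Ioo, sub_zero, ENNReal.toReal_ofReal (by linarith)]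

lemma measurable_indicator_move (hΩ : MeasurableSet Ω) (hE : Measurable E) (p : Phase) :
    Measurable fun t : ℝ => (above Ω).indicator E (move p t) :=
  (hE.indicator (measurableSet_above hΩ)).comp (measurable_move.comp measurable_prodMk_left)

lemma integrable_emissionAlong (hΩ : MeasurableSet Ω) (hE : Measurable E) {p : Phase}
    (hfin : ∫⁻ t : ℝ, (above Ω).indicator E (move p t) < ⊤) :
    Integrable (emissionAlong Ω E p) :=
  integrable_toReal_of_lintegral_ne_top (measurable_indicator_move hΩ hE p).aemeasurable hfin.ne

/-- Along a characteristic the generated intensity solves the transfer equation by variation of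
constants. -/
lemma intensity_move (hα : 0 < α) (hΩo : IsOpen Ω) (hΩb : Bornology.IsBounded Ω)
    (hΩc : Convex ℝ Ω) (hE : Measurable E) {p : Phase} (hp : p ∈ above Ω)
    (hg : g p.1 p.2.2 ≠ ⊤)
    (hfin : ∫⁻ t : ℝ, (above Ω).indicator E (move p t) < ⊤) {t : ℝ} (ht : move p t ∈ above Ω) :
    intensity α Ω g E (move p t) ≠ ⊤ ∧ (intensity α Ω g E (move p t)).toReal
      = lineSol α (emissionAlong Ω E p) (entryDist Ω p) (g p.1 p.2.2).toReal t := by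
  obtain ⟨hs, -, hiff⟩ := entryDist_spec hΩo hΩb hΩc hp
  have hst := (hiff t t ht le_rfl).1 ht
  set s := entryDist Ω p with hsdef
  set β := emissionAlong Ω E p with hβ
  have hEm := measurable_indicator_move hΩo.measurableSet hE p
  set F : ℝ → ENNReal := fun r => ENNReal.ofReal (α * Real.exp (-α * r))
    * (above Ω).indicator E (move (move p t) (-r)) with hF
  have hFm : Measurable F := by
    refine Measurable.mul (by fun_prop) ?_
    simp only [move_move]
    exact hEm.comp (by fun_prop : Measurable fun r : ℝ => t + -r)
  have hFfin : ∫⁻ r in Ioi (0 : ℝ), F r < ⊤ := by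
    calc ∫⁻ r in Ioi (0 : ℝ), F r
        ≤ ∫⁻ r in Ioi (0 : ℝ), ENNReal.ofReal α * (above Ω).indicator E (move p (t - r)) := by
          refine setLIntegral_mono' measurableSet_Ioi fun r (hr : 0 < r) => ?_
          simp only [hF, move_move, ← sub_eq_add_neg]
          gcongr
          have : Real.exp (-α * r) ≤ 1 := Real.exp_le_one_iff.2 (by nlinarith)
          nlinarith
      _ ≤ ∫⁻ r, ENNReal.ofReal α * (above Ω).indicator E (move p (t - r)) :=
          setLIntegral_le_lintegral _ _
      _ = ENNReal.ofReal α * ∫⁻ r, (above Ω).indicator E (move p r) := by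
          rw [lintegral_const_mul' _ _ ENNReal.ofReal_ne_top,
            lintegral_sub_left_eq_self (fun r => (above Ω).indicator E (move p r))]
      _ < ⊤ := ENNReal.mul_lt_top ENNReal.ofReal_lt_top hfin
  have hgfin : g p.1 p.2.2 * ENNReal.ofReal (Real.exp (-α * entryDist Ω (move p t))) ≠ ⊤ :=
    ENNReal.mul_ne_top hg ENNReal.ofReal_ne_top
  have hint : intensity α Ω g E (move p t) = g p.1 p.2.2
      * ENNReal.ofReal (Real.exp (-α * entryDist Ω (move p t))) + ∫⁻ r in Ioi (0 : ℝ), F r := rfl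
  refine ⟨by rw [hint]; exact ENNReal.add_ne_top.2 ⟨hgfin, hFfin.ne⟩, ?_⟩
  rw [hint, ENNReal.toReal_add hgfin hFfin.ne, ENNReal.toReal_mul,
    ENNReal.toReal_ofReal (Real.exp_pos _).le, entryDist_move hΩo hΩb hΩc hp ht, ← hsdef,
    ← integral_toReal hFm.aemeasurable (ae_lt_top hFm hFfin.ne)]
  have e1 : ∀ r, 0 < r → (F r).toReal = α * Real.exp (-α * r) * β (t - r) := by
    intro r _
    simp only [hF]
    rw [ENNReal.toReal_mul, ENNReal.toReal_ofReal (by positivity), move_move, ← sub_eq_add_neg]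
    rfl
  have hzero : ∀ q, q ≤ -s → q ≤ t → β q = 0 := by
    intro q hq hqt
    have : move p q ∉ above Ω := fun h => by linarith [(hiff t q ht hqt).1 h]
    simp [hβ, emissionAlong, this]
  have e2 : ∫ r in Ioi (0 : ℝ), (F r).toReal
      = ∫ r in (0 : ℝ)..(s + t), α * Real.exp (-α * r) * β (t - r) := by
    rw [setIntegral_congr_fun measurableSet_Ioi fun r hr => e1 r hr,
      intervalIntegral.integral_of_le (by linarith)]
    refine setIntegral_eq_of_subset_of_forall_sdiff_eq_zero measurableSet_Ioi
      (fun r hr => hr.1) fun r hr => ?_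
    have hr0 : 0 < r := hr.1
    have hr1 : s + t < r := by
      by_contra hcon
      exact hr.2 ⟨hr0, not_lt.1 hcon⟩
    rw [hzero (t - r) (by linarith) (by linarith), mul_zero]
  have e3 : ∫ r in (0 : ℝ)..(s + t), α * Real.exp (-α * r) * β (t - r)
      = Real.exp (-α * t) * ∫ q in (-s)..t, α * Real.exp (α * q) * β q := by
    have h := intervalIntegral.integral_comp_sub_left
      (fun q => α * Real.exp (-α * (t - q)) * β q) (a := 0) (b := s + t) t
    simp only [sub_sub_cancel, sub_zero] at h
    rw [h, ← intervalIntegral.integral_const_mul]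
    have e : t - (s + t) = -s := by ring
    rw [e]
    refine intervalIntegral.integral_congr fun q _ => ?_
    have : Real.exp (-α * (t - q)) = Real.exp (-α * t) * Real.exp (α * q) := by
      rw [← Real.exp_add]; ring_nf
    simp only [this]
    ring
  rw [e2, e3, lineSol, mul_add (-α) s t, Real.exp_add]
  ring

end Intensity

/-! ### Integration over frequencies and directions -/

section Marginal

/-- The measure `dν dn` on `(0, ∞) × 𝕊²`. -/
abbrev spectralMeasure : Measure (ℝ × Dir) := freqMeasure.prod dirMeasure

variable {Ω : Set Space}

lemma measurePreserving_marginal (Ω : Set Space) :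
    MeasurePreserving (fun q : Space × (ℝ × Dir) => ((q.2.1, q.1, q.2.2) : Phase))
      ((volume.restrict Ω).prod spectralMeasure) (phaseMeasure Ω) := by
  have h1 := (measurePreserving_prodAssoc (volume.restrict Ω) freqMeasure dirMeasure).symm
  have h2 := (Measure.measurePreserving_swap (μ := volume.restrict Ω) (ν := freqMeasure)).prod
    (MeasurePreserving.id dirMeasure)
  have h3 := measurePreserving_prodAssoc freqMeasure (volume.restrict Ω) dirMeasure
  exact h3.comp (h2.comp h1)

lemma measurable_fiber (x : Space) : Measurable fun z : ℝ × Dir => ((z.1, x, z.2) : Phase) := by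
  fun_prop

lemma lintegral_phaseMeasure {F : Phase → ENNReal} (hF : Measurable F) :
    ∫⁻ p, F p ∂(phaseMeasure Ω) = ∫⁻ x in Ω, ∫⁻ z, F (z.1, x, z.2) ∂spectralMeasure := by
  have hmp := measurePreserving_marginal Ω
  rw [← hmp.lintegral_comp hF]
  exact lintegral_prod (fun q : Space × (ℝ × Dir) => F (q.2.1, q.1, q.2.2))
    (hF.comp hmp.measurable).aemeasurable

lemma integrable_marginal {f : Phase → ℝ} (hf : Integrable f (phaseMeasure Ω)) :
    Integrable (fun q : Space × (ℝ × Dir) => f (q.2.1, q.1, q.2.2))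
      ((volume.restrict Ω).prod spectralMeasure) :=
  (measurePreserving_marginal Ω).integrable_comp_of_integrable hf

lemma integral_phaseMeasure {f : Phase → ℝ} (hf : Integrable f (phaseMeasure Ω)) :
    ∫ p, f p ∂(phaseMeasure Ω) = ∫ x in Ω, ∫ z, f (z.1, x, z.2) ∂spectralMeasure := by
  have hmp := measurePreserving_marginal Ω
  conv_lhs => rw [← hmp.map_eq]
  rw [integral_map hmp.aemeasurable (by rw [hmp.map_eq]; exact hf.1)]
  exact integral_prod _ (integrable_marginal hf)

lemma ae_marginal {P : Phase → Prop} (h : ∀ᵐ p ∂(phaseMeasure Ω), P p) :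
    ∀ᵐ x ∂(volume.restrict Ω), ∀ᵐ z ∂spectralMeasure, P (z.1, x, z.2) :=
  Measure.ae_ae_of_ae_prod ((measurePreserving_marginal Ω).quasiMeasurePreserving.ae h)

lemma ae_phase_mem (hΩ : MeasurableSet Ω) :
    ∀ᵐ p ∂(phaseMeasure Ω), p ∈ above Ω ∧ 0 < p.1 := by
  have h1 : ∀ᵐ p ∂(phaseMeasure Ω), p ∈ above Ω := by
    rw [phaseMeasure_eq]
    exact ae_restrict_mem (measurableSet_above hΩ)
  have h2 : ∀ᵐ p ∂(phaseMeasure Ω), 0 < p.1 :=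
    Measure.quasiMeasurePreserving_fst.ae (ae_restrict_mem measurableSet_Ioi)
  exact h1.and h2

end Marginal

/-! ### Solutions of the transfer equation are generated by their emission -/

section Transfer

variable {h c k α : ℝ} {Ω : Set Space} {T : Space → ℝ} {g : ℝ → Dir → ℝ}

/-- The emission of a black body of temperature `T`. -/
def emission (h c k : ℝ) (T : Space → ℝ) (p : Phase) : ENNReal :=
  ENNReal.ofReal (planck h c k p.1 (T p.2.1))

lemma measurable_emission (hT : Measurable T) : Measurable (emission h c k T) :=
  (measurable_planck.comp
    (by fun_prop : Measurable fun p : Phase => (p.1, T p.2.1))).ennreal_ofReal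

lemma lintegral_emission (hh : 0 < h) (hk : 0 < k) {x : Space} (hT : Measurable T)
    (hx : 0 < T x) :
    ∫⁻ z : ℝ × Dir, emission h c k T (z.1, x, z.2) ∂spectralMeasure
      = dirMeasure univ * ENNReal.ofReal (stefan h c k * T x ^ 4) := by
  have hm : Measurable fun z : ℝ × Dir => emission h c k T (z.1, x, z.2) :=
    (measurable_emission hT).comp (measurable_fiber x)
  rw [lintegral_prod _ hm.aemeasurable]
  simp only [emission, lintegral_const]
  have hm' : Measurable fun ν => ENNReal.ofReal (planck h c k ν (T x)) :=
    (measurable_planck.comp (by fun_prop : Measurable fun ν : ℝ => (ν, T x))).ennreal_ofReal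
  rw [lintegral_mul_const _ hm', lintegral_planck hh hk hx, mul_comm]

lemma lintegral_emission_lt_top (hh : 0 < h) (hk : 0 < k) (hΩ : MeasurableSet Ω)
    (hT : Measurable T) (hTpos : ∀ x ∈ Ω, 0 < T x)
    (hw : ∫⁻ x in Ω, ENNReal.ofReal (stefan h c k * T x ^ 4) < ⊤) :
    ∫⁻ p, emission h c k T p ∂(phaseMeasure Ω) < ⊤ := by
  rw [lintegral_phaseMeasure (measurable_emission hT),
    setLIntegral_congr_fun hΩ fun x hx => lintegral_emission hh hk hT (hTpos x hx),
    lintegral_const_mul _ (by fun_prop)]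
  exact ENNReal.mul_lt_top (measure_lt_top _ _) hw

/-- On almost every characteristic the emission is integrable. -/
lemma ae_lintegral_emission_lt_top (hh : 0 < h) (hk : 0 < k) (hΩ : MeasurableSet Ω)
    (hΩb : Bornology.IsBounded Ω) (hT : Measurable T) (hTpos : ∀ x ∈ Ω, 0 < T x)
    (hw : ∫⁻ x in Ω, ENNReal.ofReal (stefan h c k * T x ^ 4) < ⊤) :
    ∀ᵐ p ∂(phaseMeasure Ω), ∫⁻ t : ℝ, (above Ω).indicator (emission h c k T) (move p t) < ⊤ := by
  have hE := measurable_emission (h := h) (c := c) (k := k) hT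
  refine ae_lt_top ?_ (lintegral_lintegral_move_lt_top hΩ hΩb hE
    (lintegral_emission_lt_top hh hk hΩ hT hTpos hw)).ne
  exact Measurable.lintegral_prod_right'
    (f := fun q : Phase × ℝ => (above Ω).indicator (emission h c k T) (move q.1 q.2))
    ((hE.indicator (measurableSet_above hΩ)).comp measurable_move)

lemma emissionAlong_eq (hh : 0 < h) (hk : 0 < k) (hTpos : ∀ x ∈ Ω, 0 < T x) {p : Phase}
    (hν : 0 < p.1) {t : ℝ} (ht : p.2.1 + t • (p.2.2 : Space) ∈ Ω) :
    emissionAlong Ω (emission h c k T) p t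
      = planck h c k p.1 (T (p.2.1 + t • (p.2.2 : Space))) := by
  have ht' : move p t ∈ above Ω := ht
  rw [emissionAlong, indicator_of_mem ht', emission,
    ENNReal.toReal_ofReal (planck_nonneg hh hk (by exact hν) (hTpos _ ht'))]
  rfl

/-- The intensity generated by the black body emission and the incoming data `g`. -/
def generated (h c k α : ℝ) (Ω : Set Space) (T : Space → ℝ) (g : ℝ → Dir → ℝ) (p : Phase) :
    ENNReal :=
  intensity α Ω (fun ν n => ENNReal.ofReal (g ν n)) (emission h c k T) p

lemma measurable_generated (hΩ : MeasurableSet Ω) (hT : Measurable T)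
    (hg : Measurable fun z : ℝ × Dir => g z.1 z.2) : Measurable (generated h c k α Ω T g) :=
  measurable_intensity (g := fun ν n => ENNReal.ofReal (g ν n)) hΩ hg.ennreal_ofReal
    (measurable_emission hT)

lemma absolutelyContinuousOnInterval_congr {f₁ f₂ : ℝ → ℝ} {a b : ℝ}
    (hf : AbsolutelyContinuousOnInterval f₁ a b) (h : ∀ t ∈ uIcc a b, f₂ t = f₁ t) :
    AbsolutelyContinuousOnInterval f₂ a b := by
  rw [absolutelyContinuousOnInterval_iff] at hf ⊢
  intro ε hε
  obtain ⟨δ, hδ, H⟩ := hf ε hε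
  refine ⟨δ, hδ, fun E hE hlen => ?_⟩
  convert H E hE hlen using 1
  refine Finset.sum_congr rfl fun i hi => ?_
  rw [h _ (hE.1 i hi).1, h _ (hE.1 i hi).2]

/-- The generated intensity satisfies the transfer equation. -/
lemma solvesTransferEquation_generated (hh : 0 < h) (hk : 0 < k) (hα : 0 < α) (hΩo : IsOpen Ω)
    (hΩb : Bornology.IsBounded Ω) (hΩc : Convex ℝ Ω) (hT : Measurable T)
    (hTpos : ∀ x ∈ Ω, 0 < T x)
    (hw : ∫⁻ x in Ω, ENNReal.ofReal (stefan h c k * T x ^ 4) < ⊤) :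
    SolvesTransferEquation h c k α Ω T
      (fun ν x n => (generated h c k α Ω T g (ν, x, n)).toReal) := by
  have hΩ := hΩo.measurableSet
  have hE := measurable_emission (h := h) (c := c) (k := k) hT
  filter_upwards [ae_phase_mem hΩ, ae_lintegral_emission_lt_top hh hk hΩ hΩb hT hTpos hw]
    with p hp hfin
  obtain ⟨hpm, hν⟩ := hp
  have hβ := integrable_emissionAlong hΩ hE hfin
  set β := emissionAlong Ω (emission h c k T) p
  have heq : ∀ t, p.2.1 + t • (p.2.2 : Space) ∈ Ω →
      (generated h c k α Ω T g (p.1, p.2.1 + t • (p.2.2 : Space), p.2.2)).toReal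
        = lineSol α β (entryDist Ω p) (ENNReal.ofReal (g p.1 p.2.2)).toReal t := fun t ht =>
    (intensity_move (g := fun ν n => ENNReal.ofReal (g ν n)) hα hΩo hΩb hΩc hE hpm
      ENNReal.ofReal_ne_top hfin ht).2
  intro a b hab hseg
  constructor
  · refine absolutelyContinuousOnInterval_congr
      (absolutelyContinuousOnInterval_lineSol (α := α) hβ (entryDist Ω p)
        (ENNReal.ofReal (g p.1 p.2.2)).toReal a b) fun t ht => ?_
    rw [uIcc_of_le hab] at ht
    exact heq t (hseg t ht)
  · rw [ae_restrict_iff' measurableSet_Icc]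
    filter_upwards [ae_hasDerivAt_lineSol (α := α) hβ (entryDist Ω p)
      (ENNReal.ofReal (g p.1 p.2.2)).toReal] with t ht htab
    have hmem := hseg t htab
    have hopen : IsOpen {r : ℝ | p.2.1 + r • (p.2.2 : Space) ∈ Ω} := hΩo.preimage (by fun_prop)
    have h2 := ht.congr_of_eventuallyEq
      (Filter.mem_of_superset (hopen.mem_nhds hmem) fun r hr => heq r hr)
    rw [← heq t hmem, show β t = _ from emissionAlong_eq hh hk hTpos hν hmem] at h2
    exact h2

/-- The generated intensity assumes the incoming data. -/
lemma hasIncomingData_generated (hh : 0 < h) (hk : 0 < k) (hα : 0 < α) (hΩo : IsOpen Ω)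
    (hΩb : Bornology.IsBounded Ω) (hΩc : Convex ℝ Ω) (hT : Measurable T)
    (hTpos : ∀ x ∈ Ω, 0 < T x)
    (hw : ∫⁻ x in Ω, ENNReal.ofReal (stefan h c k * T x ^ 4) < ⊤)
    (hg0 : ∀ ν n, 0 ≤ g ν n) :
    HasIncomingData Ω g (fun ν x n => (generated h c k α Ω T g (ν, x, n)).toReal) := by
  have hΩ := hΩo.measurableSet
  have hE := measurable_emission (h := h) (c := c) (k := k) hT
  filter_upwards [ae_phase_mem hΩ, ae_lintegral_emission_lt_top hh hk hΩ hΩb hT hTpos hw]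
    with p hp hfin
  obtain ⟨hpm, hν⟩ := hp
  have hβ := integrable_emissionAlong hΩ hE hfin
  set β := emissionAlong Ω (emission h c k T) p
  intro s y m hs hy hyfr _ _
  obtain ⟨hs0, hfr, hiff⟩ := entryDist_spec hΩo hΩb hΩc hpm
  have hsE : s = entryDist Ω p :=
    frontier_unique hΩo hΩc hpm p.2.2 hs (by rwa [hy] at hyfr) hfr hs0
  have hlim : Tendsto (fun t : ℝ => lineSol α β s (g p.1 p.2.2) (t - s)) (𝓝[>] 0)
      (𝓝 (g p.1 p.2.2)) := by
    have hc : Continuous fun t : ℝ => lineSol α β s (g p.1 p.2.2) (t - s) :=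
      (continuous_lineSol hβ s _).comp (by fun_prop)
    have := (hc.tendsto 0).mono_left (nhdsWithin_le_nhds (s := Ioi 0))
    rwa [zero_sub, lineSol_neg_self] at this
  refine hlim.congr' ?_
  filter_upwards [Ioo_mem_nhdsGT hs] with t ht
  have hmem : move p (t - s) ∈ above Ω :=
    (hiff 0 (t - s) (by simpa using hpm) (by linarith [ht.2])).2 (by linarith [ht.1])
  have h1 := (intensity_move (g := fun ν n => ENNReal.ofReal (g ν n)) hα hΩo hΩb hΩc hE hpm
      ENNReal.ofReal_ne_top hfin hmem).2
  rw [ENNReal.toReal_ofReal (hg0 _ _), ← hsE] at h1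
  rw [← h1, generated]
  congr 2
  simp only [move, hy, sub_smul]
  congr 2
  abel

/-- Every solution of the transfer equation with incoming data `g` is the generated one. -/
lemma ae_eq_generated (hh : 0 < h) (hk : 0 < k) (hα : 0 < α) (hΩo : IsOpen Ω)
    (hΩb : Bornology.IsBounded Ω) (hΩc : Convex ℝ Ω) (hC1 : HasC1Boundary Ω) (hT : Measurable T)
    (hTpos : ∀ x ∈ Ω, 0 < T x)
    (hw : ∫⁻ x in Ω, ENNReal.ofReal (stefan h c k * T x ^ 4) < ⊤)
    (hg0 : ∀ ν n, 0 ≤ g ν n) {I : ℝ → Space → Dir → ℝ}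
    (htr : SolvesTransferEquation h c k α Ω T I) (hin : HasIncomingData Ω g I) :
    ∀ᵐ p ∂(phaseMeasure Ω), generated h c k α Ω T g p ≠ ⊤ ∧
      I p.1 p.2.1 p.2.2 = (generated h c k α Ω T g p).toReal := by
  have hΩ := hΩo.measurableSet
  have hE := measurable_emission (h := h) (c := c) (k := k) hT
  filter_upwards [ae_phase_mem hΩ, ae_lintegral_emission_lt_top hh hk hΩ hΩb hT hTpos hw, htr, hin]
    with p hp hfin htr hin
  obtain ⟨hpm, hν⟩ := hp
  have hβ := integrable_emissionAlong hΩ hE hfin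
  have hpm0 : move p 0 ∈ above Ω := by simpa using hpm
  have hgen := intensity_move (g := fun ν n => ENNReal.ofReal (g ν n)) hα hΩo hΩb hΩc hE hpm
      ENNReal.ofReal_ne_top hfin hpm0
  rw [move_zero, ENNReal.toReal_ofReal (hg0 _ _)] at hgen
  refine ⟨hgen.1, ?_⟩
  rw [generated, hgen.2]
  obtain ⟨hs0, hfr, hiff⟩ := entryDist_spec hΩo hΩb hΩc hpm
  set s := entryDist Ω p with hs
  have := eq_lineSol (J := fun t : ℝ => I p.1 (p.2.1 + t • (p.2.2 : Space)) p.2.2) hβ hs0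
    (c := g p.1 p.2.2) (α := α) ?_ ?_
  · simpa using this
  · intro a ha ha0
    have hseg : ∀ t ∈ Icc a 0, p.2.1 + t • (p.2.2 : Space) ∈ Ω := fun t ht =>
      (hiff 0 t hpm0 ht.2).2 (ha.trans_le ht.1)
    obtain ⟨h1, h2⟩ := htr a 0 ha0 hseg
    refine ⟨h1, ?_⟩
    rw [ae_restrict_iff' measurableSet_Icc] at h2 ⊢
    filter_upwards [h2] with t ht hta
    rw [emissionAlong_eq hh hk hTpos hν (hseg t hta)]
    exact ht hta
  · obtain ⟨m, hm, hneg⟩ := exists_normal_inner_neg hΩo hΩc hC1 hfr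
    have h1 := hneg (s • (p.2.2 : Space)) (by simpa [above] using hpm)
    rw [inner_smul_left, conj_trivial] at h1
    have h2 := hin s _ m hs0 rfl hfr hm (by
      by_contra hcon
      exact absurd h1 (not_lt.2 (mul_nonneg hs0.le (not_lt.1 hcon))))
    have hshift : Tendsto (fun t : ℝ => t + s) (𝓝[>] (-s)) (𝓝[>] 0) := by
      refine tendsto_nhdsWithin_iff.2 ⟨?_, ?_⟩
      · have : Continuous fun t : ℝ => t + s := by fun_prop
        simpa using (this.tendsto (-s)).mono_left (nhdsWithin_le_nhds (s := Ioi (-s)))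
      · filter_upwards [self_mem_nhdsWithin] with t ht
        have : -s < t := ht
        exact show 0 < t + s by linarith
    refine (h2.comp hshift).congr fun t => ?_
    simp only [Function.comp, add_smul]
    congr 1
    abel

end Transfer

/-! ### The conservation law as a balance of emission and absorption -/

section Conservation

variable {h c k α : ℝ} {Ω : Set Space} {T : Space → ℝ} {I : ℝ → Space → Dir → ℝ} {φ : Space → ℝ}

lemma hasDerivAt_test (hφ : ContDiff ℝ ∞ φ) (x v : Space) (t : ℝ) :
    HasDerivAt (fun t : ℝ => φ (x + t • v)) (inner ℝ v (gradient φ (x + t • v))) t := by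
  have hg : HasGradientAt φ (gradient φ (x + t • v)) (x + t • v) :=
    ((hφ.differentiable (by simp)) _).hasGradientAt
  have hline : HasDerivAt (fun t : ℝ => x + t • v) v t := by
    simpa using ((hasDerivAt_id t).smul_const v).const_add x
  have hd := hg.hasFDerivAt.comp_hasDerivAt t hline
  rwa [InnerProductSpace.toDual_apply_apply, real_inner_comm] at hd

lemma gradient_eq_zero_of_notMem_tsupport {x : Space} (hx : x ∉ tsupport φ) :
    gradient φ x = 0 := by
  rw [gradient, fderiv_of_notMem_tsupport ℝ hx, map_zero]

lemma continuous_gradient (hφ : ContDiff ℝ ∞ φ) : Continuous (gradient φ) :=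
  (LinearIsometryEquiv.continuous _).comp (hφ.continuous_fderiv (by simp))

lemma exists_bound_test (hφ : ContDiff ℝ ∞ φ) (hsupp : HasCompactSupport φ) :
    ∃ C, (∀ x, ‖φ x‖ ≤ C) ∧ ∀ x, ‖gradient φ x‖ ≤ C := by
  obtain ⟨C₁, h1⟩ := hsupp.exists_bound_of_continuous hφ.continuous
  have hs : HasCompactSupport (gradient φ) := by
    refine HasCompactSupport.intro hsupp fun x hx => gradient_eq_zero_of_notMem_tsupport hx
  obtain ⟨C₂, h2⟩ := hs.exists_bound_of_continuous (continuous_gradient hφ)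
  exact ⟨max C₁ C₂, fun x => (h1 x).trans (le_max_left _ _),
    fun x => (h2 x).trans (le_max_right _ _)⟩

/-- Integration by parts on a single characteristic, against a test function supported in `Ω`. -/
lemma setIntegral_line_eq_zero (hΩo : IsOpen Ω) (hΩb : Bornology.IsBounded Ω) (hΩc : Convex ℝ Ω)
    (hφ : ContDiff ℝ ∞ φ) (hφΩ : tsupport φ ⊆ Ω) {x : Space} (hx : x ∈ Ω) (n : Dir)
    {J J' : ℝ → ℝ}
    (hJ : ∀ a b : ℝ, a ≤ b → (∀ t ∈ Icc a b, x + t • (n : Space) ∈ Ω) →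
      AbsolutelyContinuousOnInterval J a b ∧
        ∀ᵐ t ∂(volume.restrict (Icc a b)), HasDerivAt J (J' t) t) :
    ∫ t in {t : ℝ | x + t • (n : Space) ∈ Ω}, (J' t * φ (x + t • (n : Space))
      + J t * inner ℝ (n : Space) (gradient φ (x + t • (n : Space)))) = 0 := by
  obtain ⟨D, -, hD, -⟩ := exists_chord_bound hΩb
  have hcont : Continuous fun t : ℝ => x + t • (n : Space) := by fun_prop
  set L := {t : ℝ | x + t • (n : Space) ∈ Ω} with hL
  have hLo : IsOpen L := hΩo.preimage hcont
  have hLc : OrdConnected L := ordConnected_chord hΩc x n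
  set C := {t : ℝ | x + t • (n : Space) ∈ tsupport φ} with hC
  have hCL : C ⊆ L := fun t ht => hφΩ ht
  have hCc : IsCompact C := by
    refine Metric.isCompact_of_isClosed_isBounded ((isClosed_tsupport φ).preimage hcont) ?_
    exact (Metric.isBounded_Icc (-D) D).subset fun t ht => abs_le.1 (hD x hx n t (hCL ht))
  have hzero : ∀ t, t ∉ C → φ (x + t • (n : Space)) = 0 ∧
      gradient φ (x + t • (n : Space)) = 0 := fun t ht =>
    ⟨image_eq_zero_of_notMem_tsupport ht, gradient_eq_zero_of_notMem_tsupport ht⟩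
  rcases C.eq_empty_or_nonempty with hCe | hCne
  · refine integral_eq_zero_of_ae (Eventually.of_forall fun t => ?_)
    have h0 := hzero t (by rw [hCe]; exact notMem_empty t)
    simp [h0.1, h0.2]
  -- enlarge the support to an interval inside the chord, at whose ends the test function vanishes
  obtain ⟨a, haL, ha⟩ : ∃ a ∈ L, a < sInf C := by
    obtain ⟨ε, hε, hb⟩ := Metric.isOpen_iff.1 hLo _ (hCL (hCc.sInf_mem hCne))
    refine ⟨sInf C - ε / 2, hb ?_, by linarith⟩
    rw [Metric.mem_ball, Real.dist_eq, sub_sub_cancel_left, abs_neg, abs_of_pos (by positivity)]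
    linarith
  obtain ⟨b, hbL, hb⟩ : ∃ b ∈ L, sSup C < b := by
    obtain ⟨ε, hε, hb⟩ := Metric.isOpen_iff.1 hLo _ (hCL (hCc.sSup_mem hCne))
    refine ⟨sSup C + ε / 2, hb ?_, by linarith⟩
    rw [Metric.mem_ball, Real.dist_eq, add_sub_cancel_left, abs_of_pos (by positivity)]
    linarith
  have hCab : ∀ t ∈ C, a < t ∧ t < b := fun t ht =>
    ⟨ha.trans_le (csInf_le hCc.bddBelow ht), (le_csSup hCc.bddAbove ht).trans_lt hb⟩
  have hab : a ≤ b := by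
    obtain ⟨t, ht⟩ := hCne
    exact ((hCab t ht).1.trans (hCab t ht).2).le
  have hseg : Icc a b ⊆ L := hLc.out haL hbL
  obtain ⟨h1, h2⟩ := hJ a b hab hseg
  have hIBP := integral_deriv_mul_test_eq_zero (ψ := fun t : ℝ => φ (x + t • (n : Space))) hab h1 h2
    ((hφ.of_le (by simp)).comp (by fun_prop)) (hasDerivAt_test hφ x (n : Space))
    (hzero a fun ht => lt_irrefl _ (hCab a ht).1).1 (hzero b fun ht => lt_irrefl _ (hCab b ht).2).1
  rw [intervalIntegral.integral_of_le hab, ← integral_Icc_eq_integral_Ioc] at hIBP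
  rw [← hIBP]
  refine setIntegral_eq_of_subset_of_forall_sdiff_eq_zero hLo.measurableSet hseg fun t ht => ?_
  have h0 := hzero t fun htC => ht.2 ⟨(hCab t htC).1.le, (hCab t htC).2.le⟩
  rw [h0.1, h0.2, mul_zero, inner_zero_right, mul_zero, add_zero]

lemma integrable_mul_inner_gradient
    (hI : Integrable (fun p : Phase => I p.1 p.2.1 p.2.2) (phaseMeasure Ω))
    (hφ : ContDiff ℝ ∞ φ) (hsupp : HasCompactSupport φ) :
    Integrable (fun p : Phase => I p.1 p.2.1 p.2.2
      * inner ℝ (p.2.2 : Space) (gradient φ p.2.1)) (phaseMeasure Ω) := by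
  obtain ⟨C, -, hC2⟩ := exists_bound_test hφ hsupp
  have hcg := continuous_gradient hφ
  refine hI.mul_bdd (c := C) ?_ (Eventually.of_forall fun p => ?_)
  · exact (by fun_prop : Continuous fun p : Phase =>
      inner ℝ (p.2.2 : Space) (gradient φ p.2.1)).aestronglyMeasurable
  · refine (norm_inner_le_norm _ _).trans ?_
    rw [norm_dir, one_mul]
    exact hC2 _

lemma integrable_mul_test {f : Phase → ℝ} (hf : Integrable f (phaseMeasure Ω))
    (hφ : ContDiff ℝ ∞ φ) (hsupp : HasCompactSupport φ) :
    Integrable (fun p : Phase => f p * φ p.2.1) (phaseMeasure Ω) := by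
  obtain ⟨C, hC1, -⟩ := exists_bound_test hφ hsupp
  have hφc := hφ.continuous
  refine hf.mul_bdd (c := C) ?_ (Eventually.of_forall fun p => hC1 _)
  exact (by fun_prop : Continuous fun p : Phase => φ p.2.1).aestronglyMeasurable

/-- The weak form of the transfer equation over phase space. -/
lemma integral_weak_transfer (hΩo : IsOpen Ω) (hΩb : Bornology.IsBounded Ω) (hΩc : Convex ℝ Ω)
    (hI : Integrable (fun p : Phase => I p.1 p.2.1 p.2.2) (phaseMeasure Ω))
    (hB : Integrable (fun p : Phase => planck h c k p.1 (T p.2.1)) (phaseMeasure Ω))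
    (htr : SolvesTransferEquation h c k α Ω T I)
    (hφ : ContDiff ℝ ∞ φ) (hsupp : HasCompactSupport φ) (hφΩ : tsupport φ ⊆ Ω) :
    ∫ p : Phase, I p.1 p.2.1 p.2.2 * inner ℝ (p.2.2 : Space) (gradient φ p.2.1) ∂(phaseMeasure Ω)
      = -(α * ∫ p : Phase, (planck h c k p.1 (T p.2.1) - I p.1 p.2.1 p.2.2) * φ p.2.1
        ∂(phaseMeasure Ω)) := by
  have i1 := integrable_mul_inner_gradient hI hφ hsupp
  have i2 : Integrable (fun p : Phase => (planck h c k p.1 (T p.2.1) - I p.1 p.2.1 p.2.2)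
      * φ p.2.1) (phaseMeasure Ω) :=
      integrable_mul_test (hB.sub hI) hφ hsupp
  have key := integral_eq_zero_of_ae_integral_move hΩo hΩb ((i2.const_mul α).add i1) (by
    filter_upwards [ae_phase_mem hΩo.measurableSet, htr] with p hp htr
    have := setIntegral_line_eq_zero hΩo hΩb hΩc hφ hφΩ (x := p.2.1) hp.1 p.2.2 htr
    simpa only [move, Pi.add_apply, mul_assoc] using this)
  rw [integral_add' (i2.const_mul α) i1, integral_const_mul] at key
  linarith

lemma integral_inner_flux (hI : Integrable (fun p : Phase => I p.1 p.2.1 p.2.2) (phaseMeasure Ω))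
    (hφ : ContDiff ℝ ∞ φ) (hsupp : HasCompactSupport φ) :
    ∫ x in Ω, inner ℝ (flux I x) (gradient φ x)
      = ∫ p : Phase, I p.1 p.2.1 p.2.2 * inner ℝ (p.2.2 : Space) (gradient φ p.2.1)
        ∂(phaseMeasure Ω) := by
  have i1 := integrable_mul_inner_gradient hI hφ hsupp
  rw [integral_phaseMeasure i1]
  refine integral_congr_ae ?_
  filter_upwards [(integrable_marginal hI).prod_right_ae] with x hx
  have hvec : Integrable (fun z : ℝ × Dir => I z.1 x z.2 • (z.2 : Space)) spectralMeasure := by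
    refine hx.smul_bdd 1 ?_ (Eventually.of_forall fun z => by rw [norm_dir])
    exact (by fun_prop : Continuous fun z : ℝ × Dir => (z.2 : Space)).aestronglyMeasurable
  have hflux : flux I x = ∫ z : ℝ × Dir, I z.1 x z.2 • (z.2 : Space) ∂spectralMeasure := by
    rw [integral_prod _ hvec]
    rfl
  rw [hflux, real_inner_comm, ← integral_inner hvec]
  refine integral_congr_ae (Eventually.of_forall fun z => ?_)
  simp only [inner_smul_right]
  rw [real_inner_comm]

/-- For a solution of the transfer equation, the total flux is divergence free exactly when, at
almost every point, as much energy is emitted as is absorbed. -/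
lemma isDivergenceFree_flux_iff (hα : 0 < α) (hΩo : IsOpen Ω) (hΩb : Bornology.IsBounded Ω)
    (hΩc : Convex ℝ Ω)
    (hI : Integrable (fun p : Phase => I p.1 p.2.1 p.2.2) (phaseMeasure Ω))
    (hB : Integrable (fun p : Phase => planck h c k p.1 (T p.2.1)) (phaseMeasure Ω))
    (htr : SolvesTransferEquation h c k α Ω T I) :
    IsDivergenceFree Ω (flux I) ↔ ∀ᵐ x ∂(volume.restrict Ω),
      ∫ z : ℝ × Dir, planck h c k z.1 (T x) ∂spectralMeasure
        = ∫ z : ℝ × Dir, I z.1 x z.2 ∂spectralMeasure := by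
  set b : Space → ℝ := fun x => ∫ z : ℝ × Dir, planck h c k z.1 (T x) ∂spectralMeasure
    - ∫ z : ℝ × Dir, I z.1 x z.2 ∂spectralMeasure with hb
  have hbi : IntegrableOn b Ω :=
    (integrable_marginal hB).integral_prod_left.sub (integrable_marginal hI).integral_prod_left
  have hweak : ∀ φ : Space → ℝ, ContDiff ℝ ∞ φ → HasCompactSupport φ → tsupport φ ⊆ Ω →
      ∫ x in Ω, inner ℝ (flux I x) (gradient φ x) = -(α * ∫ x in Ω, φ x * b x) := by
    intro φ hφ hsupp hφΩ
    have i2 : Integrable (fun p : Phase => (planck h c k p.1 (T p.2.1) - I p.1 p.2.1 p.2.2)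
        * φ p.2.1) (phaseMeasure Ω) :=
      integrable_mul_test (hB.sub hI) hφ hsupp
    rw [integral_inner_flux hI hφ hsupp, integral_weak_transfer hΩo hΩb hΩc hI hB htr hφ hsupp hφΩ,
      integral_phaseMeasure i2]
    congr 2
    refine integral_congr_ae ?_
    filter_upwards [(integrable_marginal hI).prod_right_ae,
      (integrable_marginal hB).prod_right_ae] with x hx1 hx2
    rw [integral_mul_const, integral_sub hx2 hx1, mul_comm]
  constructor
  · intro hdiv
    have h0 := hΩo.ae_eq_zero_of_integral_contDiff_smul_eq_zero (μ := volume.restrict Ω) (f := b)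
      ((Integrable.locallyIntegrable hbi).locallyIntegrableOn Ω) fun φ hφ hsupp hφΩ => by
        have := hdiv φ hφ hsupp hφΩ
        rw [hweak φ hφ hsupp hφΩ] at this
        simpa [hα.ne'] using this
    filter_upwards [h0, ae_restrict_mem hΩo.measurableSet] with x hx hxΩ
    exact sub_eq_zero.1 (hx hxΩ)
  · intro hbal φ hφ hsupp hφΩ
    rw [hweak φ hφ hsupp hφΩ]
    have : ∫ x in Ω, φ x * b x = 0 := by
      refine integral_eq_zero_of_ae ?_
      filter_upwards [hbal] with x hx
      simp [hb, hx]
    rw [this]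
    simp

end Conservation

/-! ### Changing the data on null sets -/

section Congruence

variable {h c k α : ℝ} {Ω : Set Space} {I : ℝ → Space → Dir → ℝ}

lemma SolvesTransferEquation.congr {T T' : Space → ℝ} (hΩ : MeasurableSet Ω)
    (hTT' : T =ᵐ[volume.restrict Ω] T') (htr : SolvesTransferEquation h c k α Ω T I) :
    SolvesTransferEquation h c k α Ω T' I := by
  have h1 : ∀ᵐ p ∂(phaseMeasure Ω), T p.2.1 = T' p.2.1 :=
    (Measure.quasiMeasurePreserving_fst.comp Measure.quasiMeasurePreserving_snd).ae hTT'
  filter_upwards [htr, ae_ae_move hΩ h1] with p hp hae a b hab hseg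
  obtain ⟨h2, h3⟩ := hp a b hab hseg
  refine ⟨h2, ?_⟩
  rw [ae_restrict_iff' measurableSet_Icc] at h3 ⊢
  filter_upwards [h3, hae] with t ht hTt hta
  have e : T (p.2.1 + t • (p.2.2 : Space)) = T' (p.2.1 + t • (p.2.2 : Space)) := hTt (hseg t hta)
  rw [← e]
  exact ht hta

lemma ae_data_eq {g g' : ℝ → Dir → ℝ}
    (hgg' : (fun z : ℝ × Dir => g z.1 z.2) =ᵐ[spectralMeasure] fun z => g' z.1 z.2) :
    ∀ᵐ p ∂(phaseMeasure Ω), g p.1 p.2.2 = g' p.1 p.2.2 := by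
  have hq : Measure.QuasiMeasurePreserving
      (Prod.map id Prod.snd : ℝ × Space × Dir → ℝ × Dir) (phaseMeasure Ω) spectralMeasure :=
    QuasiMeasurePreserving.prodMap (Measure.QuasiMeasurePreserving.id freqMeasure)
      Measure.quasiMeasurePreserving_snd
  exact hq.ae hgg'

lemma HasIncomingData.congr {g g' : ℝ → Dir → ℝ}
    (hgg' : (fun z : ℝ × Dir => g z.1 z.2) =ᵐ[spectralMeasure] fun z => g' z.1 z.2)
    (hin : HasIncomingData Ω g I) : HasIncomingData Ω g' I := by
  filter_upwards [hin, ae_data_eq hgg'] with p hp hgp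
  rwa [← hgp]

end Congruence

/-! ### The integral equation for the emitted energy -/

section IntegralEquation

/-- The energy that the incoming data, attenuated, bring to the point `x`. -/
def source (α : ℝ) (Ω : Set Space) (g : ℝ → Dir → ℝ) (x : Space) : ENNReal :=
  ∫⁻ z, ENNReal.ofReal (g z.1 z.2)
    * ENNReal.ofReal (Real.exp (-α * entryDist Ω (z.1, x, z.2))) ∂spectralMeasure

/-- The energy that arrives at `x` if every point `y` of `Ω` emits `w y` in each direction. -/
def received (α : ℝ) (Ω : Set Space) (w : Space → ENNReal) (x : Space) : ENNReal :=
  ∫⁻ n : Dir, (∫⁻ t in Ioi (0 : ℝ), ENNReal.ofReal (α * Real.exp (-α * t))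
    * Ω.indicator w (x + (-t) • (n : Space))) ∂dirMeasure

/-- The fraction of the energy that is absorbed on a path of length `D`. -/
def absorbedFraction (α D : ℝ) : ENNReal :=
  ∫⁻ t in Ioc (0 : ℝ) D, ENNReal.ofReal (α * Real.exp (-α * t))

variable {h c k α : ℝ} {Ω : Set Space} {g : ℝ → Dir → ℝ} {w : Space → ENNReal}

lemma absorbedFraction_lt_one (hα : 0 < α) {D : ℝ} (hD : 0 < D) : absorbedFraction α D < 1 := by
  have hint : ∫ t in (0 : ℝ)..D, α * Real.exp (-α * t) = 1 - Real.exp (-α * D) := by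
    have hd : ∀ t ∈ uIcc 0 D, HasDerivAt (fun t => -Real.exp (-α * t)) (α * Real.exp (-α * t)) t :=
      fun t _ => by
        have := (hasDerivAt_exp_mul (-α) t).neg
        exact this.congr_deriv (by ring)
    rw [intervalIntegral.integral_eq_sub_of_hasDerivAt hd
      (Continuous.intervalIntegrable (by fun_prop) _ _)]
    simp
    ring
  have hi : IntegrableOn (fun t => α * Real.exp (-α * t)) (Ioc 0 D) :=
    (intervalIntegrable_iff_integrableOn_Ioc_of_le hD.le).1
      (Continuous.intervalIntegrable (by fun_prop) _ _)
  rw [absorbedFraction, ← ofReal_integral_eq_lintegral_ofReal hi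
    (Eventually.of_forall fun t => by positivity), ← intervalIntegral.integral_of_le hD.le, hint,
    ENNReal.ofReal_lt_one]
  linarith [Real.exp_pos (-α * D)]

lemma measurable_kernel (hΩ : MeasurableSet Ω) (hw : Measurable w) :
    Measurable fun q : (Space × Dir) × ℝ => ENNReal.ofReal (α * Real.exp (-α * q.2))
      * Ω.indicator w (q.1.1 + (-q.2) • (q.1.2 : Space)) := by
  refine Measurable.mul (by fun_prop) ((hw.indicator hΩ).comp ?_)
  exact (by fun_prop : Continuous fun q : (Space × Dir) × ℝ =>
    q.1.1 + (-q.2) • (q.1.2 : Space)).measurable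

lemma measurable_kernel_line (hΩ : MeasurableSet Ω) (hw : Measurable w) (x : Space) (n : Dir) :
    Measurable fun t : ℝ => ENNReal.ofReal (α * Real.exp (-α * t))
      * Ω.indicator w (x + (-t) • (n : Space)) :=
  (measurable_kernel (α := α) hΩ hw).comp (by fun_prop : Measurable fun t : ℝ => ((x, n), t))

lemma measurable_lintegral_kernel (hΩ : MeasurableSet Ω) (hw : Measurable w) (x : Space) :
    Measurable fun n : Dir => ∫⁻ t in Ioi (0 : ℝ), ENNReal.ofReal (α * Real.exp (-α * t))
      * Ω.indicator w (x + (-t) • (n : Space)) :=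
  ((measurable_kernel (α := α) hΩ hw).lintegral_prod_right'
    (ν := volume.restrict (Ioi (0 : ℝ)))).comp (by fun_prop : Measurable fun n : Dir => (x, n))

lemma measurable_received (hΩ : MeasurableSet Ω) (hw : Measurable w) :
    Measurable (received α Ω w) :=
  ((measurable_kernel hΩ hw).lintegral_prod_right' (ν := volume.restrict (Ioi (0 : ℝ)))
    ).lintegral_prod_right' (ν := dirMeasure)

lemma measurable_source (hΩ : MeasurableSet Ω) (hg : Measurable fun z : ℝ × Dir => g z.1 z.2) :
    Measurable (source α Ω g) := by
  refine Measurable.lintegral_prod_right' (f := fun q : Space × (ℝ × Dir) =>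
    ENNReal.ofReal (g q.2.1 q.2.2)
      * ENNReal.ofReal (Real.exp (-α * entryDist Ω (q.2.1, q.1, q.2.2)))) ?_
  refine Measurable.mul (hg.comp measurable_snd).ennreal_ofReal (Measurable.ennreal_ofReal ?_)
  refine Real.measurable_exp.comp (Measurable.const_mul ?_ _)
  exact (measurable_entryDist hΩ).comp
    (by fun_prop : Measurable fun q : Space × (ℝ × Dir) => ((q.2.1, q.1, q.2.2) : Phase))

/-- The total energy that the generated intensity transports through `x`. -/
lemma lintegral_generated (hh : 0 < h) (hk : 0 < k) (hΩ : MeasurableSet Ω) {T : Space → ℝ}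
    (hT : Measurable T) (hTpos : ∀ x ∈ Ω, 0 < T x)
    (hg : Measurable fun z : ℝ × Dir => g z.1 z.2) (x : Space) :
    ∫⁻ z, generated h c k α Ω T g (z.1, x, z.2) ∂spectralMeasure
      = source α Ω g x + received α Ω (fun y => ENNReal.ofReal (stefan h c k * T y ^ 4)) x := by
  have hm1 : Measurable fun z : ℝ × Dir => ENNReal.ofReal (g z.1 z.2)
      * ENNReal.ofReal (Real.exp (-α * entryDist Ω (z.1, x, z.2))) := by
    refine Measurable.mul hg.ennreal_ofReal (Measurable.ennreal_ofReal ?_)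
    exact Real.measurable_exp.comp
      (((measurable_entryDist hΩ).comp (measurable_fiber x)).const_mul _)
  simp only [generated, intensity]
  rw [lintegral_add_left hm1, ← source]
  congr 1
  have hE := (measurable_emission (h := h) (c := c) (k := k) hT).indicator (measurableSet_above hΩ)
  have hF : Measurable fun q : (ℝ × Dir) × ℝ => ENNReal.ofReal (α * Real.exp (-α * q.2))
      * (above Ω).indicator (emission h c k T) (move (q.1.1, x, q.1.2) (-q.2)) := by
    have hp : Measurable fun q : (ℝ × Dir) × ℝ => (((q.1.1, x, q.1.2) : Phase), q.2) := by
      fun_prop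
    exact Measurable.mul (by fun_prop) ((hE.comp measurable_move_neg).comp hp)
  have hF' : Measurable fun z : ℝ × Dir => ∫⁻ t in Ioi (0 : ℝ),
      ENNReal.ofReal (α * Real.exp (-α * t))
        * (above Ω).indicator (emission h c k T) (move (z.1, x, z.2) (-t)) :=
    hF.lintegral_prod_right' (ν := volume.restrict (Ioi (0 : ℝ)))
  rw [lintegral_prod_symm _ hF'.aemeasurable, received]
  refine lintegral_congr fun n => ?_
  rw [lintegral_lintegral_swap]
  · refine lintegral_congr fun t => ?_
    have hm : Measurable fun ν : ℝ =>
        (above Ω).indicator (emission h c k T) (move (ν, x, n) (-t)) :=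
      (hE.comp measurable_move_neg).comp
        (by fun_prop : Measurable fun ν : ℝ => (((ν, x, n) : Phase), t))
    rw [lintegral_const_mul _ hm]
    congr 1
    by_cases hy : x + (-t) • (n : Space) ∈ Ω
    · have hy' : ∀ ν : ℝ, move (ν, x, n) (-t) ∈ above Ω := fun ν => hy
      rw [indicator_of_mem hy, ← lintegral_planck hh hk (hTpos _ hy)]
      refine lintegral_congr fun ν => ?_
      rw [indicator_of_mem (hy' ν)]
      rfl
    · have hy' : ∀ ν : ℝ, move (ν, x, n) (-t) ∉ above Ω := fun ν => hy
      rw [indicator_of_notMem hy]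
      simp [hy']
  · exact (hF.comp (by fun_prop : Measurable fun q : ℝ × ℝ => ((q.1, n), q.2))).aemeasurable

/-- Seen from a point of `Ω`, the emission is confined to the distances below the diameter. -/
lemma received_eq {D : ℝ} (hΩb : ∀ x ∈ Ω, ∀ (n : Dir) (t : ℝ), x + t • (n : Space) ∈ Ω → |t| ≤ D)
    {x : Space} (hx : x ∈ Ω) :
    received α Ω w x = ∫⁻ n : Dir, (∫⁻ t in Ioc (0 : ℝ) D, ENNReal.ofReal (α * Real.exp (-α * t))
      * Ω.indicator w (x + (-t) • (n : Space))) ∂dirMeasure := by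
  refine lintegral_congr fun n => ?_
  rw [← lintegral_indicator measurableSet_Ioi, ← lintegral_indicator measurableSet_Ioc]
  refine lintegral_congr fun t => ?_
  by_cases ht : t ∈ Ioi (0 : ℝ)
  · by_cases ht' : t ≤ D
    · rw [indicator_of_mem ht, indicator_of_mem (show t ∈ Ioc 0 D from ⟨ht, ht'⟩)]
    · have hy : x + (-t) • (n : Space) ∉ Ω := fun hy => ht' (by
        have := hΩb x hx n (-t) hy
        rw [abs_neg] at this
        exact (le_abs_self t).trans this)
      rw [indicator_of_mem ht, indicator_of_notMem (fun hh : t ∈ Ioc 0 D => ht' hh.2),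
        indicator_of_notMem hy, mul_zero]
  · rw [indicator_of_notMem ht, indicator_of_notMem (fun hh : t ∈ Ioc 0 D => ht hh.1)]

/-- The uniform bound for the received energy. -/
lemma received_le {D : ℝ} (hΩb : ∀ x ∈ Ω, ∀ (n : Dir) (t : ℝ), x + t • (n : Space) ∈ Ω → |t| ≤ D)
    {S : ENNReal} (hwS : ∀ y ∈ Ω, w y ≤ S) {x : Space} (hx : x ∈ Ω) :
    received α Ω w x ≤ dirMeasure univ * (absorbedFraction α D * S) := by
  rw [received_eq hΩb hx]
  calc _ ≤ ∫⁻ _ : Dir, absorbedFraction α D * S ∂dirMeasure := by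
        refine lintegral_mono fun n => ?_
        rw [absorbedFraction, ← lintegral_mul_const _ (by fun_prop)]
        refine lintegral_mono fun t => ?_
        gcongr
        exact indicator_le (fun y hy => hwS y hy) _
    _ = _ := by rw [lintegral_const, mul_comm]

/-- The contraction estimate in `L¹(Ω)`. -/
lemma lintegral_received_le {D : ℝ} (hΩ : MeasurableSet Ω)
    (hΩb : ∀ x ∈ Ω, ∀ (n : Dir) (t : ℝ), x + t • (n : Space) ∈ Ω → |t| ≤ D) (hw : Measurable w) :
    ∫⁻ x in Ω, received α Ω w x
      ≤ dirMeasure univ * (absorbedFraction α D * ∫⁻ x in Ω, w x) := by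
  have hm := measurable_kernel (α := α) hΩ hw
  rw [setLIntegral_congr_fun hΩ fun x hx => received_eq hΩb hx]
  refine (setLIntegral_le_lintegral _ _).trans (le_of_eq ?_)
  rw [lintegral_lintegral_swap
    (hm.lintegral_prod_right' (ν := volume.restrict (Ioc (0 : ℝ) D))).aemeasurable]
  have : ∀ n : Dir, ∫⁻ x : Space, ∫⁻ t in Ioc (0 : ℝ) D, ENNReal.ofReal (α * Real.exp (-α * t))
      * Ω.indicator w (x + (-t) • (n : Space)) = absorbedFraction α D * ∫⁻ x in Ω, w x := by
    intro n
    have hmn : Measurable fun q : Space × ℝ => ENNReal.ofReal (α * Real.exp (-α * q.2))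
        * Ω.indicator w (q.1 + (-q.2) • (n : Space)) :=
      hm.comp (by fun_prop : Measurable fun q : Space × ℝ => ((q.1, n), q.2))
    rw [lintegral_lintegral_swap hmn.aemeasurable, absorbedFraction,
      ← lintegral_mul_const _ (by fun_prop)]
    refine lintegral_congr fun t => ?_
    rw [lintegral_const_mul' _ _ ENNReal.ofReal_ne_top,
      lintegral_add_right_eq_self (Ω.indicator w), lintegral_indicator hΩ]
  simp_rw [this]
  rw [lintegral_const, mul_comm]

lemma received_mono_add {w₁ w₂ w₃ : Space → ENNReal} (hΩ : MeasurableSet Ω)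
    (h2 : Measurable w₂) (h : ∀ y, w₁ y ≤ w₂ y + w₃ y) (x : Space) :
    received α Ω w₁ x ≤ received α Ω w₂ x + received α Ω w₃ x := by
  unfold received
  rw [← lintegral_add_left (measurable_lintegral_kernel hΩ h2 x)]
  refine lintegral_mono fun n => ?_
  rw [← lintegral_add_left (measurable_kernel_line hΩ h2 x n)]
  refine lintegral_mono fun t => ?_
  rw [← mul_add]
  gcongr
  by_cases hy : x + (-t) • (n : Space) ∈ Ω
  · simpa [hy, -neg_smul] using h _
  · simp [hy, -neg_smul]

lemma received_tsum {u : ℕ → Space → ENNReal} (hΩ : MeasurableSet Ω)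
    (hu : ∀ j, Measurable (u j)) (x : Space) :
    received α Ω (fun y => ∑' j, u j y) x = ∑' j, received α Ω (u j) x := by
  unfold received
  rw [← lintegral_tsum fun j => (measurable_lintegral_kernel hΩ (hu j) x).aemeasurable]
  refine lintegral_congr fun n => ?_
  rw [← lintegral_tsum fun j => (measurable_kernel_line hΩ (hu j) x n).aemeasurable]
  refine lintegral_congr fun t => ?_
  rw [ENNReal.tsum_mul_left]
  congr 1
  by_cases hy : x + (-t) • (n : Space) ∈ Ω <;> simp [hy, -neg_smul]

lemma source_le (hα : 0 < α) (x : Space) :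
    source α Ω g x ≤ ∫⁻ z, ENNReal.ofReal (g z.1 z.2) ∂spectralMeasure := by
  refine lintegral_mono fun z => mul_le_of_le_one_right' ?_
  rw [ENNReal.ofReal_le_one, Real.exp_le_one_iff]
  have : 0 ≤ entryDist Ω (z.1, x, z.2) := ENNReal.toReal_nonneg
  nlinarith

lemma source_pos (hΩ : MeasurableSet Ω) (hg : Measurable fun z : ℝ × Dir => g z.1 z.2)
    (hgpos : 0 < ∫⁻ z, ENNReal.ofReal (g z.1 z.2) ∂spectralMeasure) (x : Space) :
    0 < source α Ω g x := by
  rw [pos_iff_ne_zero] at hgpos ⊢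
  intro h0
  apply hgpos
  rw [source, lintegral_eq_zero_iff] at h0
  · refine lintegral_eq_zero_of_ae_eq_zero ?_
    filter_upwards [h0] with z hz
    have hz' := mul_eq_zero.1 hz
    refine hz'.resolve_right ?_
    exact (ENNReal.ofReal_pos.2 (Real.exp_pos _)).ne'
  · refine Measurable.mul hg.ennreal_ofReal (Measurable.ennreal_ofReal ?_)
    exact Real.measurable_exp.comp
      (((measurable_entryDist hΩ).comp (measurable_fiber x)).const_mul _)

/-- Existence for the integral equation, by a Neumann series; the solution is bounded, and positive
where the source is. -/
lemma exists_solution_integral_equation (hα : 0 < α) (hΩ : MeasurableSet Ω)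
    (hΩb : Bornology.IsBounded Ω) (hm : dirMeasure univ ≠ 0) {G : Space → ENNReal}
    (hG : Measurable G) {S : ENNReal} (hS : S ≠ ⊤) (hGS : ∀ x, G x ≤ S) :
    ∃ w : Space → ENNReal, Measurable w ∧
      (∀ x, dirMeasure univ * w x = G x + received α Ω w x) ∧
      ∃ B : ENNReal, B ≠ ⊤ ∧ ∀ x ∈ Ω, w x ≤ B := by
  obtain ⟨D, hD, hbd, -⟩ := exists_chord_bound hΩb
  set m := dirMeasure univ with hmdef
  have hmt : m ≠ ⊤ := measure_ne_top _ _
  have hmi : m⁻¹ ≠ ⊤ := ENNReal.inv_ne_top.2 hm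
  have hmm : m * m⁻¹ = 1 := ENNReal.mul_inv_cancel hm hmt
  set q := absorbedFraction α D with hq
  have hq1 : q < 1 := absorbedFraction_lt_one hα hD
  set u : ℕ → Space → ENNReal := fun j =>
    Nat.rec (fun x => m⁻¹ * G x) (fun _ v x => m⁻¹ * received α Ω v x) j with hu
  have hu0 : ∀ x, u 0 x = m⁻¹ * G x := fun x => rfl
  have hus : ∀ j x, u (j + 1) x = m⁻¹ * received α Ω (u j) x := fun j x => rfl
  have hum : ∀ j, Measurable (u j) := by
    intro j
    induction j with
    | zero => exact hG.const_mul _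
    | succ j ih => exact (measurable_received hΩ ih).const_mul _
  have hbound : ∀ j, ∀ x ∈ Ω, u j x ≤ q ^ j * (m⁻¹ * S) := by
    intro j
    induction j with
    | zero =>
      intro x _
      rw [hu0, pow_zero, one_mul]
      gcongr
      exact hGS x
    | succ j ih =>
      intro x hx
      rw [hus]
      calc m⁻¹ * received α Ω (u j) x ≤ m⁻¹ * (m * (q * (q ^ j * (m⁻¹ * S)))) := by
            gcongr
            exact received_le hbd ih hx
        _ = (m * m⁻¹) * (q * (q ^ j * (m⁻¹ * S))) := by ring
        _ = q ^ (j + 1) * (m⁻¹ * S) := by rw [hmm]; ring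
  refine ⟨fun x => ∑' j, u j x, Measurable.tsum hum, fun x => ?_,
    (1 - q)⁻¹ * (m⁻¹ * S), ?_, fun x hx => ?_⟩
  · change m * ∑' j, u j x = _
    rw [received_tsum hΩ hum, tsum_eq_zero_add' (f := fun j => u j x) ENNReal.summable, mul_add,
      hu0, ← mul_assoc, hmm,
      one_mul]
    congr 1
    rw [← ENNReal.tsum_mul_left]
    congr 1
    ext j
    rw [hus, ← mul_assoc, hmm, one_mul]
  · refine ENNReal.mul_ne_top (ENNReal.inv_ne_top.2 ?_) (ENNReal.mul_ne_top hmi hS)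
    exact (tsub_pos_of_lt hq1).ne'
  · calc ∑' j, u j x ≤ ∑' j, q ^ j * (m⁻¹ * S) := ENNReal.tsum_le_tsum fun j => hbound j x hx
      _ = (1 - q)⁻¹ * (m⁻¹ * S) := by rw [ENNReal.tsum_mul_right, ENNReal.tsum_geometric]

/-- Uniqueness for the integral equation in `L¹(Ω)`. -/
lemma ae_eq_of_integral_equation (hα : 0 < α) (hΩ : MeasurableSet Ω)
    (hΩb : Bornology.IsBounded Ω) (hm : dirMeasure univ ≠ 0) {G w₁ w₂ : Space → ENNReal}
    (h1m : Measurable w₁) (h2m : Measurable w₂)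
    (h1f : ∫⁻ x in Ω, w₁ x < ⊤) (h2f : ∫⁻ x in Ω, w₂ x < ⊤)
    (h1 : ∀ᵐ x ∂(volume.restrict Ω), dirMeasure univ * w₁ x = G x + received α Ω w₁ x)
    (h2 : ∀ᵐ x ∂(volume.restrict Ω), dirMeasure univ * w₂ x = G x + received α Ω w₂ x) :
    w₁ =ᵐ[volume.restrict Ω] w₂ := by
  obtain ⟨D, hD, hbd, -⟩ := exists_chord_bound hΩb
  set m := dirMeasure univ with hmdef
  have hmt : m ≠ ⊤ := measure_ne_top _ _
  set d : Space → ENNReal := fun x => max (w₁ x - w₂ x) (w₂ x - w₁ x) with hd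
  have hdm : Measurable d := (h1m.sub h2m).max (h2m.sub h1m)
  have hd1 : ∀ y, w₁ y ≤ w₂ y + d y := fun y =>
    tsub_le_iff_left.1 (le_max_left (w₁ y - w₂ y) (w₂ y - w₁ y))
  have hd2 : ∀ y, w₂ y ≤ w₁ y + d y := fun y =>
    tsub_le_iff_left.1 (le_max_right (w₁ y - w₂ y) (w₂ y - w₁ y))
  have hdle : ∀ᵐ x ∂(volume.restrict Ω), m * d x ≤ received α Ω d x := by
    filter_upwards [h1, h2] with x h1 h2
    have e : m * d x = max (m * w₁ x - m * w₂ x) (m * w₂ x - m * w₁ x) := by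
      simp only [hd]
      rw [mul_max, ENNReal.mul_sub fun _ _ => hmt, ENNReal.mul_sub fun _ _ => hmt]
    rw [e, h1, h2]
    refine max_le (tsub_le_iff_left.2 ?_) (tsub_le_iff_left.2 ?_)
    · rw [add_assoc]
      gcongr
      exact received_mono_add hΩ h2m hd1 x
    · rw [add_assoc]
      gcongr
      exact received_mono_add hΩ h1m hd2 x
  have hdf : ∫⁻ x in Ω, d x ≠ ⊤ := by
    refine ne_of_lt ((lintegral_mono fun x => ?_).trans_lt
      (show ∫⁻ x in Ω, (w₁ x + w₂ x) < ⊤ by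
        rw [lintegral_add_left h1m]; exact ENNReal.add_lt_top.2 ⟨h1f, h2f⟩))
    exact max_le (tsub_le_self.trans le_self_add) (tsub_le_self.trans le_add_self)
  have hmain : m * ∫⁻ x in Ω, d x ≤ m * (absorbedFraction α D * ∫⁻ x in Ω, d x) := by
    rw [← lintegral_const_mul _ hdm]
    exact (lintegral_mono_ae hdle).trans (lintegral_received_le hΩ hbd hdm)
  have hle := (ENNReal.mul_le_mul_iff_right hm hmt).1 hmain
  have hzero : ∫⁻ x in Ω, d x = 0 := by
    by_contra hne
    have := ENNReal.mul_lt_mul_left hne hdf (absorbedFraction_lt_one hα hD)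
    rw [one_mul] at this
    exact absurd hle (not_le.2 this)
  filter_upwards [(lintegral_eq_zero_iff hdm).1 hzero] with x hx
  have hx' : max (w₁ x - w₂ x) (w₂ x - w₁ x) = 0 := hx
  have h1' : w₁ x - w₂ x = 0 := nonpos_iff_eq_zero.1 (hx' ▸ le_max_left _ _)
  have h2' : w₂ x - w₁ x = 0 := nonpos_iff_eq_zero.1 (hx' ▸ le_max_right _ _)
  exact le_antisymm (tsub_eq_zero_iff_le.1 h1') (tsub_eq_zero_iff_le.1 h2')

end IntegralEquation

/-! ### Solutions of the system and solutions of the integral equation -/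

section Balance

variable {h c k α : ℝ} {Ω : Set Space} {T : Space → ℝ} {g : ℝ → Dir → ℝ}

/-- The emitted energy `σ T⁴`. -/
def emittedEnergy (h c k : ℝ) (T : Space → ℝ) (x : Space) : ENNReal :=
  ENNReal.ofReal (stefan h c k * T x ^ 4)

lemma measurable_emittedEnergy (hT : Measurable T) : Measurable (emittedEnergy h c k T) := by
  unfold emittedEnergy
  fun_prop

lemma planck_ae_eq_toReal_emission (hh : 0 < h) (hk : 0 < k) (hTpos : ∀ x ∈ Ω, 0 < T x) {x : Space}
    (hx : x ∈ Ω) :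
    (fun z : ℝ × Dir => planck h c k z.1 (T x))
      =ᵐ[spectralMeasure] fun z => (emission h c k T (z.1, x, z.2)).toReal := by
  have : ∀ᵐ z ∂spectralMeasure, z.1 ∈ Ioi (0 : ℝ) :=
    Measure.quasiMeasurePreserving_fst.ae (ae_restrict_mem measurableSet_Ioi)
  filter_upwards [this] with z hz
  rw [emission, ENNReal.toReal_ofReal (planck_nonneg hh hk hz (hTpos x hx))]

lemma integrable_planck (hh : 0 < h) (hk : 0 < k) (hΩ : MeasurableSet Ω) (hT : Measurable T)
    (hTpos : ∀ x ∈ Ω, 0 < T x) (hw : ∫⁻ x in Ω, emittedEnergy h c k T x < ⊤) :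
    Integrable (fun p : Phase => planck h c k p.1 (T p.2.1)) (phaseMeasure Ω) := by
  refine (integrable_toReal_of_lintegral_ne_top (measurable_emission hT).aemeasurable
    (lintegral_emission_lt_top hh hk hΩ hT hTpos hw).ne).congr ?_
  filter_upwards [ae_phase_mem hΩ] with p hp
  rw [emission, ENNReal.toReal_ofReal (planck_nonneg hh hk hp.2 (hTpos _ hp.1))]

/-- For a solution `I` of the transfer equation with the incoming data, the conservation law is
equivalent to the integral equation for the emitted energy. -/
lemma isDivergenceFree_iff_integral_equation (hh : 0 < h) (hk : 0 < k) (hα : 0 < α)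
    (hΩo : IsOpen Ω) (hΩb : Bornology.IsBounded Ω) (hΩc : Convex ℝ Ω) (hC1 : HasC1Boundary Ω)
    (hT : Measurable T) (hTpos : ∀ x ∈ Ω, 0 < T x)
    (hw : ∫⁻ x in Ω, emittedEnergy h c k T x < ⊤)
    (hg : Measurable fun z : ℝ × Dir => g z.1 z.2) (hg0 : ∀ ν n, 0 ≤ g ν n)
    {I : ℝ → Space → Dir → ℝ}
    (hI : Integrable (fun p : Phase => I p.1 p.2.1 p.2.2) (phaseMeasure Ω))
    (htr : SolvesTransferEquation h c k α Ω T I) (hin : HasIncomingData Ω g I) :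
    IsDivergenceFree Ω (flux I) ↔ ∀ᵐ x ∂(volume.restrict Ω),
      dirMeasure univ * emittedEnergy h c k T x
        = source α Ω g x + received α Ω (emittedEnergy h c k T) x := by
  have hΩ := hΩo.measurableSet
  have hB := integrable_planck (c := c) hh hk hΩ hT hTpos hw
  rw [isDivergenceFree_flux_iff hα hΩo hΩb hΩc hI hB htr]
  have hae : ∀ᵐ x ∂(volume.restrict Ω),
      ((∫ z : ℝ × Dir, planck h c k z.1 (T x) ∂spectralMeasure
          = ∫ z : ℝ × Dir, I z.1 x z.2 ∂spectralMeasure) ↔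
        (dirMeasure univ * emittedEnergy h c k T x
          = source α Ω g x + received α Ω (emittedEnergy h c k T) x)) := by
    filter_upwards [ae_marginal (ae_eq_generated hh hk hα hΩo hΩb hΩc hC1 hT hTpos hw hg0 htr hin),
      (integrable_marginal hI).prod_right_ae, ae_restrict_mem hΩ] with x hgen hIx hx
    have hmE : Measurable fun z : ℝ × Dir => emission h c k T (z.1, x, z.2) :=
      (measurable_emission hT).comp (measurable_fiber x)
    have hmG : Measurable fun z : ℝ × Dir => generated h c k α Ω T g (z.1, x, z.2) :=
      (measurable_generated hΩ hT hg).comp (measurable_fiber x)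
    have e1 : ∫ z : ℝ × Dir, planck h c k z.1 (T x) ∂spectralMeasure
        = (dirMeasure univ * emittedEnergy h c k T x).toReal := by
      rw [integral_congr_ae (planck_ae_eq_toReal_emission hh hk hTpos hx),
        integral_toReal hmE.aemeasurable (Eventually.of_forall fun _ => ENNReal.ofReal_lt_top),
        lintegral_emission hh hk hT (hTpos x hx), emittedEnergy]
    have e2 : ∫ z : ℝ × Dir, I z.1 x z.2 ∂spectralMeasure
        = (source α Ω g x + received α Ω (emittedEnergy h c k T) x).toReal := by
      rw [integral_congr_ae (hgen.mono fun z hz => hz.2),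
        integral_toReal hmG.aemeasurable (hgen.mono fun z hz => hz.1.lt_top),
        lintegral_generated hh hk hΩ hT hTpos hg x]
      rfl
    have hfin : source α Ω g x + received α Ω (emittedEnergy h c k T) x ≠ ⊤ := by
      have h1 : ∫⁻ z, generated h c k α Ω T g (z.1, x, z.2) ∂spectralMeasure
          = ∫⁻ z : ℝ × Dir, ENNReal.ofReal (I z.1 x z.2) ∂spectralMeasure := by
        refine lintegral_congr_ae (hgen.mono fun z hz => ?_)
        have hz2 : I z.1 x z.2 = _ := hz.2
        simp only [hz2, ENNReal.ofReal_toReal hz.1]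
      have h2 : ∫⁻ z : ℝ × Dir, ENNReal.ofReal (I z.1 x z.2) ∂spectralMeasure < ⊤ :=
        hIx.lintegral_lt_top
      rw [← h1, lintegral_generated hh hk hΩ hT hTpos hg x] at h2
      exact h2.ne
    have hfin' : dirMeasure univ * emittedEnergy h c k T x ≠ ⊤ :=
      ENNReal.mul_ne_top (measure_ne_top _ _) ENNReal.ofReal_ne_top
    rw [e1, e2, ENNReal.toReal_eq_toReal_iff' hfin' hfin]
  exact ⟨fun h => by filter_upwards [h, hae] with x h1 h2 using h2.1 h1,
    fun h => by filter_upwards [h, hae] with x h1 h2 using h2.2 h1⟩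

lemma received_congr {w₁ w₂ : Space → ENNReal} (h : ∀ y ∈ Ω, w₁ y = w₂ y) (x : Space) :
    received α Ω w₁ x = received α Ω w₂ x := by
  rw [received, received, indicator_congr h]

/-- A temperature whose emitted energy solves the integral equation solves the system. -/
lemma isSolution_generated (hh : 0 < h) (hk : 0 < k) (hα : 0 < α)
    (hΩo : IsOpen Ω) (hΩb : Bornology.IsBounded Ω) (hΩc : Convex ℝ Ω) (hC1 : HasC1Boundary Ω)
    (hT : Measurable T) (hTpos : ∀ x ∈ Ω, 0 < T x)
    (hw : ∫⁻ x in Ω, emittedEnergy h c k T x < ⊤)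
    (hg : Measurable fun z : ℝ × Dir => g z.1 z.2) (hg0 : ∀ ν n, 0 ≤ g ν n)
    (heq : ∀ x ∈ Ω, dirMeasure univ * emittedEnergy h c k T x
        = source α Ω g x + received α Ω (emittedEnergy h c k T) x) :
    IsSolution h c k α Ω g T (fun ν x n => (generated h c k α Ω T g (ν, x, n)).toReal) := by
  have hΩ := hΩo.measurableSet
  have hgm := measurable_generated (h := h) (c := c) (k := k) (α := α) hΩ hT hg
  have hI : Integrable (fun p : Phase => (generated h c k α Ω T g (p.1, p.2.1, p.2.2)).toReal)
      (phaseMeasure Ω) := by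
    refine integrable_toReal_of_lintegral_ne_top hgm.aemeasurable (ne_of_lt ?_)
    rw [lintegral_phaseMeasure hgm]
    have : ∀ x ∈ Ω, ∫⁻ z, generated h c k α Ω T g (z.1, x, z.2) ∂spectralMeasure
        = dirMeasure univ * emittedEnergy h c k T x := fun x hx => by
      rw [heq x hx, lintegral_generated hh hk hΩ hT hTpos hg x]
      rfl
    rw [setLIntegral_congr_fun hΩ this, lintegral_const_mul _ (measurable_emittedEnergy hT)]
    exact ENNReal.mul_lt_top (measure_lt_top _ _) hw
  have htr := solvesTransferEquation_generated (g := g) hh hk hα hΩo hΩb hΩc hT hTpos hw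
  have hin := hasIncomingData_generated hh hk hα hΩo hΩb hΩc hT hTpos hw hg0
  refine ⟨hI, htr, hin, ?_⟩
  rw [isDivergenceFree_iff_integral_equation hh hk hα hΩo hΩb hΩc hC1 hT hTpos hw hg hg0 hI htr hin]
  filter_upwards [ae_restrict_mem hΩ] with x hx using heq x hx

/-- Every bounded positive energy density is emitted by a measurable temperature in `L⁴(Ω)`. -/
lemma exists_temperature (hh : 0 < h) (hc : 0 < c) (hk : 0 < k) (hΩ : MeasurableSet Ω)
    (hΩb : Bornology.IsBounded Ω) {w : Space → ENNReal} (hwm : Measurable w)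
    (hwpos : ∀ x ∈ Ω, 0 < w x) {B : ENNReal} (hB : B ≠ ⊤) (hwB : ∀ x ∈ Ω, w x ≤ B) :
    ∃ T : Space → ℝ, Measurable T ∧ (∀ x ∈ Ω, 0 < T x) ∧ MemLp T 4 (volume.restrict Ω) ∧
      ∀ x ∈ Ω, emittedEnergy h c k T x = w x := by
  have hσ := stefan_pos hh hc hk
  set σ := stefan h c k with hσdef
  set T : Space → ℝ := fun x => ((w x).toReal / σ) ^ (4⁻¹ : ℝ) with hTdef
  have hTm : Measurable T := (hwm.ennreal_toReal.div_const σ).pow_const _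
  have hT4 : ∀ x, T x ^ 4 = (w x).toReal / σ := fun x => by
    have := Real.rpow_inv_natCast_pow (n := 4)
      (div_nonneg (ENNReal.toReal_nonneg (a := w x)) hσ.le) (by norm_num)
    simpa [hTdef] using this
  have hwfin : ∀ x ∈ Ω, w x ≠ ⊤ := fun x hx => ((hwB x hx).trans_lt hB.lt_top).ne
  refine ⟨T, hTm, fun x hx => ?_, ?_, fun x hx => ?_⟩
  · have := ENNReal.toReal_pos (hwpos x hx).ne' (hwfin x hx)
    exact Real.rpow_pos_of_pos (by positivity) _
  · have : IsFiniteMeasure ((volume : Measure Space).restrict Ω) :=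
      ⟨by rw [Measure.restrict_apply_univ]; exact hΩb.measure_lt_top⟩
    refine MemLp.of_bound hTm.aestronglyMeasurable ((B.toReal / σ) ^ (4⁻¹ : ℝ)) ?_
    filter_upwards [ae_restrict_mem hΩ] with x hx
    have h1 : 0 ≤ (w x).toReal / σ := div_nonneg ENNReal.toReal_nonneg hσ.le
    rw [Real.norm_of_nonneg (Real.rpow_nonneg h1 _)]
    refine Real.rpow_le_rpow h1 ?_ (by norm_num)
    exact div_le_div_of_nonneg_right (ENNReal.toReal_mono hB (hwB x hx)) hσ.le
  · rw [emittedEnergy, ← hσdef, hT4, mul_div_cancel₀ _ hσ.ne', ENNReal.ofReal_toReal (hwfin x hx)]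

/-- A positive temperature in `L⁴(Ω)` that solves the system has a representative whose emitted
energy solves the integral equation. -/
lemma IsPositiveTemperature.exists_representative (hh : 0 < h) (hk : 0 < k) (hα : 0 < α)
    (hΩo : IsOpen Ω) (hΩb : Bornology.IsBounded Ω) (hΩc : Convex ℝ Ω) (hC1 : HasC1Boundary Ω)
    (hg : Measurable fun z : ℝ × Dir => g z.1 z.2) (hg0 : ∀ ν n, 0 ≤ g ν n)
    (hsol : IsPositiveTemperature h c k α Ω g T) :
    ∃ T₁ : Space → ℝ, Measurable T₁ ∧ (∀ x, 0 < T₁ x) ∧ T =ᵐ[volume.restrict Ω] T₁ ∧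
      ∫⁻ x in Ω, emittedEnergy h c k T₁ x < ⊤ ∧
      ∀ᵐ x ∂(volume.restrict Ω), dirMeasure univ * emittedEnergy h c k T₁ x
        = source α Ω g x + received α Ω (emittedEnergy h c k T₁) x := by
  have hΩ := hΩo.measurableSet
  obtain ⟨hmem, hpos, I, hI, htr, hin, hdiv⟩ := hsol
  set T₀ := hmem.1.mk T with hT₀
  have hT₀m : Measurable T₀ := hmem.1.stronglyMeasurable_mk.measurable
  set T₁ : Space → ℝ := fun x => if 0 < T₀ x then T₀ x else 1 with hT₁
  have hT₁m : Measurable T₁ :=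
    Measurable.ite (measurableSet_lt measurable_const hT₀m) hT₀m measurable_const
  have hT₁pos : ∀ x, 0 < T₁ x := fun x => by
    simp only [hT₁]
    split_ifs with hx
    · exact hx
    · exact one_pos
  have hae : T =ᵐ[volume.restrict Ω] T₁ := by
    filter_upwards [hmem.1.ae_eq_mk, hpos] with x h1 h2
    have h3 : 0 < T₀ x := by rw [hT₀, ← h1]; exact h2
    simp only [hT₁, if_pos h3]
    exact h1
  have hw : ∫⁻ x in Ω, emittedEnergy h c k T₁ x < ⊤ := by
    have h4 := ((memLp_congr_ae hae).1 hmem).integrable_norm_pow (p := 4) (by norm_num)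
    have h5 : Integrable (fun x => stefan h c k * T₁ x ^ 4) (volume.restrict Ω) := by
      refine (h4.const_mul (stefan h c k)).congr (Eventually.of_forall fun x => ?_)
      simp only [Real.norm_of_nonneg (hT₁pos x).le]
    exact h5.lintegral_lt_top
  refine ⟨T₁, hT₁m, hT₁pos, hae, hw, ?_⟩
  exact (isDivergenceFree_iff_integral_equation hh hk hα hΩo hΩb hΩc hC1 hT₁m
    (fun x _ => hT₁pos x) hw hg hg0 hI (htr.congr hΩ hae) hin).1 hdiv

lemma IsPositiveTemperature.congr_data {g' : ℝ → Dir → ℝ}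
    (hgg' : (fun z : ℝ × Dir => g z.1 z.2) =ᵐ[spectralMeasure] fun z => g' z.1 z.2)
    (hsol : IsPositiveTemperature h c k α Ω g T) : IsPositiveTemperature h c k α Ω g' T := by
  obtain ⟨hmem, hpos, I, hI, htr, hin, hdiv⟩ := hsol
  exact ⟨hmem, hpos, I, hI, htr, hin.congr hgg', hdiv⟩

end Balance

/-- Existence and uniqueness for measurable incoming data that are nonnegative everywhere. -/
lemma exists_unique_temperature {h c k α : ℝ} (hh : 0 < h) (hc : 0 < c) (hk : 0 < k) (hα : 0 < α)
    {Ω : Set Space} (hΩo : IsOpen Ω) (hΩb : Bornology.IsBounded Ω) (hΩc : Convex ℝ Ω)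
    (hC1 : HasC1Boundary Ω) {g : ℝ → Dir → ℝ} (hg : Measurable fun z : ℝ × Dir => g z.1 z.2)
    (hg0 : ∀ ν n, 0 ≤ g ν n)
    (hgfin : ∫⁻ z, ENNReal.ofReal (g z.1 z.2) ∂spectralMeasure ≠ ⊤)
    (hgpos : 0 < ∫⁻ z, ENNReal.ofReal (g z.1 z.2) ∂spectralMeasure) :
    ∃ T : Space → ℝ, IsPositiveTemperature h c k α Ω g T ∧
      ∀ T' : Space → ℝ, IsPositiveTemperature h c k α Ω g T' → T' =ᵐ[volume.restrict Ω] T := by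
  have hΩ := hΩo.measurableSet
  have hm : dirMeasure univ ≠ 0 := by
    intro h0
    have : spectralMeasure = 0 := by
      rw [spectralMeasure, Measure.measure_univ_eq_zero.1 h0, Measure.prod_zero]
    rw [this, lintegral_zero_measure] at hgpos
    exact lt_irrefl _ hgpos
  obtain ⟨w, hwm, hweq, B, hB, hwB⟩ := exists_solution_integral_equation hα hΩ hΩb hm
    (measurable_source (α := α) hΩ hg) hgfin (source_le hα)
  have hwpos : ∀ x, 0 < w x := fun x => by
    rw [pos_iff_ne_zero]
    intro h0
    have h1 := hweq x
    rw [h0, mul_zero] at h1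
    have h2 := source_pos (α := α) hΩ hg hgpos x
    exact h2.ne' (add_eq_zero.1 h1.symm).1
  obtain ⟨T, hTm, hTpos, hTmem, hTw⟩ :=
    exists_temperature hh hc hk hΩ hΩb hwm (fun x _ => hwpos x) hB hwB
  have hw : ∫⁻ x in Ω, emittedEnergy h c k T x < ⊤ := by
    rw [setLIntegral_congr_fun hΩ hTw]
    refine (setLIntegral_mono' hΩ hwB).trans_lt ?_
    rw [setLIntegral_const]
    exact ENNReal.mul_lt_top hB.lt_top hΩb.measure_lt_top
  have heq : ∀ x ∈ Ω, dirMeasure univ * emittedEnergy h c k T x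
      = source α Ω g x + received α Ω (emittedEnergy h c k T) x := fun x hx => by
    rw [hTw x hx, hweq x, received_congr hTw x]
  refine ⟨T, ⟨hTmem, (ae_restrict_mem hΩ).mono hTpos, _,
    isSolution_generated hh hk hα hΩo hΩb hΩc hC1 hTm hTpos hw hg hg0 heq⟩, fun T' hT' => ?_⟩
  obtain ⟨T₁, hT₁m, hT₁pos, hae, hw₁, heq₁⟩ :=
    hT'.exists_representative hh hk hα hΩo hΩb hΩc hC1 hg hg0
  have huniq := ae_eq_of_integral_equation hα hΩ hΩb hm (measurable_emittedEnergy hT₁m)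
    (measurable_emittedEnergy hTm) hw₁ hw heq₁ ((ae_restrict_mem hΩ).mono heq)
  refine hae.trans ?_
  filter_upwards [huniq, ae_restrict_mem hΩ] with x hx hxΩ
  have hσ := stefan_pos hh hc hk
  rw [emittedEnergy, emittedEnergy, ENNReal.ofReal_eq_ofReal_iff (by positivity) (by positivity)]
    at hx
  exact (pow_left_inj₀ (hT₁pos x).le (hTpos x hxΩ).le (by norm_num)).1
    (mul_left_cancel₀ hσ.ne' hx)

end RadiativeTransfer

end

theorem theorem3p1
    (h c k α : ℝ) (hh : 0 < h) (hc : 0 < c) (hk : 0 < k) (hα : 0 < α)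
    (Ω : Set RadiativeTransfer.Space) (hΩ_open : IsOpen Ω) (hΩ_nonempty : Ω.Nonempty)
    (hΩ_bounded : Bornology.IsBounded Ω) (hΩ_convex : Convex ℝ Ω)
    (hΩ_C1 : RadiativeTransfer.HasC1Boundary Ω)
    (g : ℝ → RadiativeTransfer.Dir → ℝ) (hg_nonneg : ∀ ν : ℝ, 0 < ν → ∀ n, 0 ≤ g ν n)
    (hg_int : Integrable (fun p : ℝ × RadiativeTransfer.Dir => g p.1 p.2)
      (RadiativeTransfer.freqMeasure.prod RadiativeTransfer.dirMeasure))
    (hg_pos : 0 < ∫ p : ℝ × RadiativeTransfer.Dir, g p.1 p.2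
      ∂(RadiativeTransfer.freqMeasure.prod RadiativeTransfer.dirMeasure)) :
    ∃ T : RadiativeTransfer.Space → ℝ,
      RadiativeTransfer.IsPositiveTemperature h c k α Ω g T ∧
      ∀ T' : RadiativeTransfer.Space → ℝ,
        RadiativeTransfer.IsPositiveTemperature h c k α Ω g T' →
          T' =ᵐ[volume.restrict Ω] T := by
  -- replace `g` by a representative that is measurable and nonnegative everywhere
  set g₀ := hg_int.1.mk (fun p : ℝ × RadiativeTransfer.Dir => g p.1 p.2) with hg₀
  have hg₀m : Measurable g₀ := hg_int.1.stronglyMeasurable_mk.measurable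
  have hnn : ∀ᵐ z ∂(RadiativeTransfer.spectralMeasure), 0 ≤ g z.1 z.2 := by
    have : ∀ᵐ z ∂(RadiativeTransfer.spectralMeasure), z.1 ∈ Ioi (0 : ℝ) :=
      Measure.quasiMeasurePreserving_fst.ae (ae_restrict_mem measurableSet_Ioi)
    filter_upwards [this] with z hz using hg_nonneg z.1 hz z.2
  have hae : (fun z : ℝ × RadiativeTransfer.Dir => g z.1 z.2)
      =ᵐ[RadiativeTransfer.spectralMeasure] fun z => max (g₀ (z.1, z.2)) 0 := by
    filter_upwards [hnn, hg_int.1.ae_eq_mk] with z h1 h2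
    have h3 : g z.1 z.2 = g₀ (z.1, z.2) := h2
    rw [← h3, max_eq_left h1]
  have hlint : ∫⁻ z, ENNReal.ofReal (max (g₀ (z.1, z.2)) 0) ∂(RadiativeTransfer.spectralMeasure)
      = ENNReal.ofReal (∫ p : ℝ × RadiativeTransfer.Dir, g p.1 p.2
        ∂(RadiativeTransfer.spectralMeasure)) := by
    rw [ofReal_integral_eq_lintegral_ofReal hg_int hnn]
    refine lintegral_congr_ae (hae.mono fun z hz => ?_)
    have hz' : g z.1 z.2 = max (g₀ (z.1, z.2)) 0 := hz
    simp only [hz']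
  obtain ⟨T, hT, huniq⟩ := RadiativeTransfer.exists_unique_temperature hh hc hk hα hΩ_open
    hΩ_bounded hΩ_convex hΩ_C1 (g := fun ν n => max (g₀ (ν, n)) 0)
    (hg₀m.max measurable_const) (fun _ _ => le_max_right _ _)
    (by rw [hlint]; exact ENNReal.ofReal_ne_top)
    (by rw [hlint]; exact ENNReal.ofReal_pos.2 hg_pos)
  exact ⟨T, hT.congr_data hae.symm, fun T' hT' => huniq T' (hT'.congr_data hae)⟩
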